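/- A digraph consists of a set of vertices and a set of arcs, which are ordered pairs of vertices. An oriented double ray is a digraph $R$ whose vertices can be enumerated as $(v_i)_{i\in\mathbb Z}$ without repetition such that for every $i$ exactly one of $(v_i,v_{i+1})$ and $(v_{i+1},v_i)$ is an arc, and $R$ has no other arcs. A turn of $R$ is a vertex of in-degree $2$ or out-degree $2$. A copy of a digraph $H$ in a digraph $D$ is a (not necessarily induced) subdigraph of $D$ isomorphic to $H$; copies are disjoint if they have no common vertex. A digraph $H$ is ubiquitous if every digraph $D$ that contains $k$ pairwise disjoint copies of $H$ for every $k\in\mathbb N$ also contains infinitely many pairwise disjoint copies of $H$. Theorem. Let $R$ be an oriented double ray with at least one turn. Then $R$ is ubiquitous if and only if its set of turns is finite and has an odd number of elements. -/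

import Mathlib

universe u v

namespace Digraph

/-- `H` is an oriented double ray: its vertices can be enumerated in order type `ℤ` (by `e`) so that
any two consecutive vertices are joined by an arc in exactly one of the two directions, and there
are no arcs between non-consecutive vertices (in particular there are no loops). -/
def IsOrientedDoubleRay {V : Type*} (H : Digraph V) : Prop :=
  ∃ e : ℤ ≃ V,
    (∀ i : ℤ, Xor (H.Adj (e i) (e (i + 1))) (H.Adj (e (i + 1)) (e i))) ∧
    (∀ i j : ℤ, H.Adj (e i) (e j) → j = i + 1 ∨ i = j + 1)

/-- The in-degree of a vertex: the number of arcs ending in it. -/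
noncomputable def inDegree {V : Type*} (H : Digraph V) (v : V) : ℕ∞ :=
  {u : V | H.Adj u v}.encard

/-- The out-degree of a vertex: the number of arcs starting in it. -/
noncomputable def outDegree {V : Type*} (H : Digraph V) (v : V) : ℕ∞ :=
  {u : V | H.Adj v u}.encard

/-- The set of turns: the vertices of in-degree 2 or out-degree 2. -/
def turns {V : Type*} (H : Digraph V) : Set V :=
  {v : V | H.inDegree v = 2 ∨ H.outDegree v = 2}

/-- A copy of `H` in `D` as a (not necessarily induced) subdigraph, given by an isomorphism
from `H` to that subdigraph, that is, by an injective map on vertices that sends arcs to arcs. -/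
structure Copy {V W : Type*} (H : Digraph V) (D : Digraph W) where
  /-- The map on vertices. -/
  toFun : V → W
  injective : Function.Injective toFun
  map_adj : ∀ ⦃u v : V⦄, H.Adj u v → D.Adj (toFun u) (toFun v)

/-- The vertex set of a copy. -/
def Copy.verts {V W : Type*} {H : Digraph V} {D : Digraph W} (c : Copy H D) : Set W :=
  Set.range c.toFun

/-- `D` contains a family, indexed by `ι`, of pairwise vertex-disjoint copies of `H`. -/
def HasDisjointCopies {V W : Type*} (H : Digraph V) (D : Digraph W) (ι : Type*) : Prop :=
  ∃ c : ι → Copy H D, Pairwise fun i j => Disjoint (c i).verts (c j).verts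

/-- `H` is ubiquitous: every digraph `D` that contains `k` disjoint copies of `H` for every natural
number `k` contains infinitely many disjoint copies of `H`.
The vertex sets of the digraphs `D` range over an arbitrary universe `v`. Loops in `D` are allowed;
this makes no difference for loopless `H`, as copies of such an `H` use no loops. -/
def IsUbiquitous {V : Type u} (H : Digraph V) : Prop :=
  ∀ (W : Type v) (D : Digraph W),
    (∀ k : ℕ, HasDisjointCopies H D (Fin k)) → HasDisjointCopies H D ℕ

end Digraph

namespace Digraph

/-! Read along `ℤ`, the double ray is a word `d : ℤ → Bool`, and a turn is a change of letter. If
the turns are finite in number, that number is odd exactly when the extreme letters differ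
(`odd_ncard_turnPositions_iff`), that is, when both ends are out-rays or both are in-rays.

Odd case: reversing arcs if necessary, both ends are out-rays, so any tail may be continued along
any other tail. Given `n` copies and many fresh disjoint ones, a stable-matching argument
(`exists_rerouting`) diverts the `2n` old tails so that they touch at most `2n` fresh tails, and a
fresh copy with both tails untouched is added (`AlmostDisjoint.exists_succ`). Longer and longer
segments are frozen, so a limit exists. There, copies meet only where the tail of an earlier one
hits the finite core of a later one; a greedy colouring extracts an infinite disjoint family.

Even case: in `grid`, copy `n` comes down column `n` to its first turn at height `0` and leaves from
its last turn along row `n`, which starts between columns `2n` and `2n + 1`. Hence copies `k, …, 2k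
- 1` are disjoint. But every copy in the grid has its first turn at height `0` and its out-ray above
that height, and an out-ray crosses every such in-ray whose column is far enough to the right.

Infinite case: in `glued`, sources of double rays are identified with sinks of others at distant
places, so that any two legs with infinitely many turns, on double rays numbered `a` and `b > 2a`,
are glued infinitely often. Again `k, …, 2k - 1` give disjoint copies. A ray that changes double
rays at a gluing has no turn there, whereas `GoodPlace` ensures that its word so far forces one if
the gluing is late enough. So each copy uses finitely many gluings (`IsTrace.switchesAt_lt`) and
ends on a single leg; among infinitely many copies, two end on legs that are glued. -/

variable {V W ι : Type*}

/-! ### Words of double rays and their turns -/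

/-- The map `f` sends the double ray with word `d` to `D`: the edge between `i` and `i + 1` is
directed towards `i + 1` if and only if `d i = true`. -/
def Follows (D : Digraph W) (d : ℤ → Bool) (f : ℤ → W) : Prop :=
  ∀ i, (d i = true → D.Adj (f i) (f (i + 1))) ∧ (d i = false → D.Adj (f (i + 1)) (f i))

/-- The enumeration `e` exhibits `R` as the oriented double ray with word `d`. -/
def IsWord (R : Digraph V) (e : ℤ ≃ V) (d : ℤ → Bool) : Prop :=
  ∀ x y : ℤ, R.Adj (e x) (e y) ↔ (y = x + 1 ∧ d x = true) ∨ (x = y + 1 ∧ d y = false)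

/-- The word of a double ray read in the opposite direction. -/
def flipWord (d : ℤ → Bool) : ℤ → Bool := fun i => !d (-i - 1)

theorem IsOrientedDoubleRay.exists_isWord {R : Digraph V} (h : R.IsOrientedDoubleRay) :
    ∃ e d, R.IsWord e d := by
  classical
  obtain ⟨e, h₁, h₂⟩ := h
  refine ⟨e, fun i => decide (R.Adj (e i) (e (i + 1))), fun x y => ⟨fun h => ?_, ?_⟩⟩
  · rcases h₂ x y h with rfl | rfl
    · exact Or.inl ⟨rfl, by simpa using h⟩
    · right
      have := h₁ y
      simp only [Xor, h, true_and, not_true, and_false, false_or] at this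
      simpa using this
  · rintro (⟨rfl, h⟩ | ⟨rfl, h⟩)
    · simpa using h
    · have := h₁ y
      simp only [decide_eq_false_iff_not] at h
      simpa [Xor, h] using this

/-- The edge between `i` and `i + 1` in the new enumeration is the old edge between `-i - 1` and
`-i`, traversed the other way; hence the index shift and the negation in `flipWord`. -/
theorem IsWord.flip {R : Digraph V} {e : ℤ ≃ V} {d : ℤ → Bool} (h : R.IsWord e d) :
    R.IsWord ((Equiv.neg ℤ).trans e) (flipWord d) := by
  intro x y
  simp only [Equiv.trans_apply, Equiv.neg_apply, h (-x) (-y), flipWord, Bool.not_eq_true',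
    Bool.not_eq_false']
  constructor
  · rintro (⟨h₁, h₂⟩ | ⟨h₁, h₂⟩)
    · exact Or.inr ⟨by omega, by rwa [show -y - 1 = -x by omega]⟩
    · exact Or.inl ⟨by omega, by rwa [show -x - 1 = -y by omega]⟩
  · rintro (⟨h₁, h₂⟩ | ⟨h₁, h₂⟩)
    · exact Or.inr ⟨by omega, by rwa [show -y = -x - 1 by omega]⟩
    · exact Or.inl ⟨by omega, by rwa [show -x = -y - 1 by omega]⟩

theorem IsWord.hasDisjointCopies_iff {R : Digraph V} {e : ℤ ≃ V} {d : ℤ → Bool}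
    (h : R.IsWord e d) (D : Digraph W) :
    R.HasDisjointCopies D ι ↔ ∃ f : ι → ℤ → W, (∀ i, Function.Injective (f i)) ∧
      (∀ i, D.Follows d (f i)) ∧ ∀ i j x y, f i x = f j y → i = j := by
  constructor
  · rintro ⟨c, hc⟩
    refine ⟨fun i x => (c i).toFun (e x), fun i => (c i).injective.comp e.injective,
      fun i x => ⟨fun hx => ?_, fun hx => ?_⟩, fun i j x y hxy => ?_⟩
    · exact (c i).map_adj ((h _ _).2 (Or.inl ⟨rfl, hx⟩))
    · exact (c i).map_adj ((h _ _).2 (Or.inr ⟨rfl, hx⟩))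
    · by_contra hij
      exact Set.disjoint_left.1 (hc hij) ⟨e x, rfl⟩ ⟨e y, hxy.symm⟩
  · rintro ⟨f, hinj, hf, hdis⟩
    refine ⟨fun i => ⟨fun x => f i (e.symm x), (hinj i).comp e.symm.injective, ?_⟩, ?_⟩
    · intro x y hxy
      obtain ⟨x, rfl⟩ := e.surjective x
      obtain ⟨y, rfl⟩ := e.surjective y
      simp only [Equiv.symm_apply_apply]
      rcases (h x y).1 hxy with ⟨rfl, hx⟩ | ⟨rfl, hx⟩
      · exact (hf i x).1 hx
      · exact (hf i y).2 hx
    · intro i j hij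
      refine Set.disjoint_left.2 ?_
      rintro _ ⟨x, rfl⟩ ⟨y, hy⟩
      exact hij (hdis _ _ _ _ hy.symm)

/-- The positions of the turns of a double ray with word `d`. -/
def turnPositions (d : ℤ → Bool) : Set ℤ := {i | d (i - 1) ≠ d i}

theorem IsWord.turns_eq {R : Digraph V} {e : ℤ ≃ V} {d : ℤ → Bool} (h : R.IsWord e d) :
    R.turns = e '' turnPositions d := by
  -- Only the two neighbouring positions can contribute to a degree; `p` and `q` record whether they
  -- do.
  have key : ∀ i : ℤ, ∀ p q : Prop,
      {v : V | ∃ y, v = e y ∧ ((y = i - 1 ∧ p) ∨ (y = i + 1 ∧ q))}.encard = 2 ↔ p ∧ q := by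
    intro i p q
    have hne : e (i - 1) ≠ e (i + 1) := fun hh => by have := e.injective hh; omega
    by_cases hp : p <;> by_cases hq : q
    · have : {v : V | ∃ y, v = e y ∧ ((y = i - 1 ∧ p) ∨ (y = i + 1 ∧ q))}
          = {e (i - 1), e (i + 1)} := by
        ext v; simp [hp, hq, and_or_left, exists_or]
      rw [this, Set.encard_pair hne]
      simp [hp, hq]
    · have : {v : V | ∃ y, v = e y ∧ ((y = i - 1 ∧ p) ∨ (y = i + 1 ∧ q))} = {e (i - 1)} := by
        ext v; simp [hp, hq]
      rw [this, Set.encard_singleton]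
      simp [hq]
    · have : {v : V | ∃ y, v = e y ∧ ((y = i - 1 ∧ p) ∨ (y = i + 1 ∧ q))} = {e (i + 1)} := by
        ext v; simp [hp, hq]
      rw [this, Set.encard_singleton]
      simp [hp]
    · have : {v : V | ∃ y, v = e y ∧ ((y = i - 1 ∧ p) ∨ (y = i + 1 ∧ q))} = ∅ := by
        ext v; simp [hp, hq]
      rw [this, Set.encard_empty]
      simp [hp]
  have hin : ∀ i, R.inDegree (e i) = 2 ↔ d (i - 1) = true ∧ d i = false := by
    intro i
    rw [← key i, inDegree]
    congr! 3
    ext v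
    obtain ⟨y, rfl⟩ := e.surjective v
    simp only [h y i, EmbeddingLike.apply_eq_iff_eq, exists_eq_left']
    constructor
    · rintro (⟨rfl, h⟩ | ⟨rfl, h⟩)
      · simp [h]
      · simp [h]
    · rintro (⟨rfl, h⟩ | ⟨rfl, h⟩)
      · simp [h]
      · simp [h]
  have hout : ∀ i, R.outDegree (e i) = 2 ↔ d (i - 1) = false ∧ d i = true := by
    intro i
    rw [← key i, outDegree]
    congr! 3
    ext v
    obtain ⟨y, rfl⟩ := e.surjective v
    simp only [h i y, EmbeddingLike.apply_eq_iff_eq, exists_eq_left']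
    constructor
    · rintro (⟨rfl, h⟩ | ⟨rfl, h⟩)
      · simp [h]
      · simp [h]
    · rintro (⟨rfl, h⟩ | ⟨rfl, h⟩)
      · simp [h]
      · simp [h]
  ext v
  obtain ⟨i, rfl⟩ := e.surjective v
  simp only [turns, Set.mem_ofPred_eq, hin, hout, turnPositions, EmbeddingLike.apply_eq_iff_eq, Set.mem_image,
    exists_eq_right]
  cases d (i - 1) <;> cases d i <;> simp

/-- If there are no turns in the interval `(a, b]`, the word is constant on `[a, b]`. -/
theorem eq_of_forall_notMem_turnPositions {d : ℤ → Bool} {a : ℤ} (n : ℕ)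
    (h : ∀ i, a < i → i ≤ a + n → i ∉ turnPositions d) : d (a + n) = d a := by
  induction n with
  | zero => simp
  | succ n ih =>
    rw [← ih fun i h₁ h₂ => h i h₁ (by push_cast; omega)]
    have := h (a + (n + 1 : ℕ)) (by push_cast; omega) le_rfl
    simp only [turnPositions, Set.mem_ofPred_eq, not_not] at this
    rw [← this]
    congr 1
    push_cast
    ring

theorem exists_bound_of_finite_turnPositions {d : ℤ → Bool} (h : (turnPositions d).Finite) :
    ∃ N : ℕ, (∀ i ∈ turnPositions d, -N < i ∧ i ≤ N) ∧ (∀ i : ℤ, N ≤ i → d i = d N) ∧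
      ∀ i : ℤ, i ≤ -N → d i = d (-N) := by
  obtain ⟨N, hN⟩ : ∃ N : ℕ, ∀ i ∈ turnPositions d, i.natAbs < N := by
    obtain ⟨N, hN⟩ := (h.image Int.natAbs).bddAbove
    exact ⟨N + 1, fun i hi => Nat.lt_succ_of_le (hN ⟨i, hi, rfl⟩)⟩
  refine ⟨N, fun i hi => by have := hN i hi; omega, fun i hi => ?_, fun i hi => ?_⟩
  · obtain ⟨n, rfl⟩ := Int.le.dest hi
    exact eq_of_forall_notMem_turnPositions n fun j h₁ _ hj => by have := hN j hj; omega
  · obtain ⟨n, hn⟩ := Int.le.dest hi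
    rw [← hn]
    exact (eq_of_forall_notMem_turnPositions n fun j _ h₂ hj => by have := hN j hj; omega).symm

theorem odd_card_turnPositions_Ioc (d : ℤ → Bool) (a : ℤ) (n : ℕ) :
    Odd ((Finset.Ioc a (a + n)).filter (fun i => d (i - 1) ≠ d i)).card ↔ d (a + n) ≠ d a := by
  induction n with
  | zero => simp
  | succ n ih =>
    have : Finset.Ioc a (a + (n + 1 : ℕ)) = insert (a + n + 1) (Finset.Ioc a (a + n)) := by
      ext i; simp only [Finset.mem_Ioc, Finset.mem_insert]; push_cast; omega
    rw [this, Finset.filter_insert, show a + ((n + 1 : ℕ) : ℤ) = a + n + 1 by push_cast; ring]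
    split_ifs with h
    · rw [Finset.card_insert_of_notMem (by simp), Nat.odd_add_one, ih]
      rw [add_sub_cancel_right] at h
      revert h
      cases d (a + n) <;> cases d (a + n + 1) <;> cases d a <;> simp
    · rw [add_sub_cancel_right, not_not] at h
      rw [ih, h]

/-- The letter flips at each turn. As `true` means an out-ray on the right but an in-ray on the
left, different letters mean ends of the same kind. -/
theorem odd_ncard_turnPositions_iff {d : ℤ → Bool} {N : ℕ}
    (h : ∀ i ∈ turnPositions d, -N < i ∧ i ≤ N) :
    Odd (turnPositions d).ncard ↔ d N ≠ d (-N) := by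
  have h₁ : turnPositions d
      = ((Finset.Ioc (-N : ℤ) (-N + (2 * N : ℕ))).filter (fun i => d (i - 1) ≠ d i) :) := by
    ext i
    simp only [Finset.coe_filter, Finset.mem_Ioc, Set.mem_ofPred_eq]
    refine ⟨fun hi => ⟨?_, hi⟩, fun hi => hi.2⟩
    have := h i hi
    push_cast
    omega
  rw [h₁, Set.ncard_coe_finset, odd_card_turnPositions_Ioc]
  have : (-N : ℤ) + (2 * N : ℕ) = N := by push_cast; ring
  rw [this]

/-- To refute ubiquity in any universe, a countable digraph in `Type` suffices. -/
theorem IsWord.not_isUbiquitous {V : Type u} {R : Digraph V} {e : ℤ ≃ V} {d : ℤ → Bool}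
    (h : R.IsWord e d) {W : Type} (D : Digraph W)
    (h₁ : ∀ k : ℕ, ∃ f : Fin k → ℤ → W, (∀ i, Function.Injective (f i)) ∧
      (∀ i, D.Follows d (f i)) ∧ ∀ i j x y, f i x = f j y → i = j)
    (h₂ : ¬ ∃ f : ℕ → ℤ → W, (∀ i, Function.Injective (f i)) ∧
      (∀ i, D.Follows d (f i)) ∧ ∀ i j x y, f i x = f j y → i = j) :
    ¬ IsUbiquitous.{u, v} R := by
  intro hu
  have := hu (ULift.{v} W) ⟨fun x y => D.Adj x.down y.down⟩ fun k => by
    obtain ⟨f, hf₁, hf₂, hf₃⟩ := h₁ k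
    rw [h.hasDisjointCopies_iff]
    refine ⟨fun i x => ⟨f i x⟩, fun i x y hxy => hf₁ i (congrArg ULift.down hxy), hf₂,
      fun i j x y hxy => hf₃ i j x y (congrArg ULift.down hxy)⟩
  rw [h.hasDisjointCopies_iff] at this
  obtain ⟨f, hf₁, hf₂, hf₃⟩ := this
  exact h₂ ⟨fun i x => (f i x).down, fun i x y hxy => hf₁ i (ULift.down_injective hxy), hf₂,
    fun i j x y hxy => hf₃ i j x y (ULift.down_injective hxy)⟩

/-! ### Rerouting rays by a stable matching -/

section Reroute

variable {I J W : Type*}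

/-- Ray `T i` proposes, in order of appearance, its vertices on the rays `S j` as places to join
these. A proposal is rejected in favour of any other proposal further along `S j`, and `T i` then
goes on. `Proposed T S i q` says that `T i` gets as far as its vertex number `q`. -/
inductive Proposed (T : I → ℕ → W) (S : J → ℕ → W) : I → ℕ → Prop
  | zero (i : I) : Proposed T S i 0
  | free {i : I} {q : ℕ} : Proposed T S i q → (∀ j k, T i q ≠ S j k) → Proposed T S i (q + 1)
  | rejected {i i' : I} {q q' : ℕ} {j : J} {k k' : ℕ} : Proposed T S i q → Proposed T S i' q' →
      T i q = S j k → T i' q' = S j k' → k < k' → Proposed T S i (q + 1)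

variable {T : I → ℕ → W} {S : J → ℕ → W}

theorem Proposed.of_succ {i : I} {q : ℕ} (h : Proposed T S i (q + 1)) : Proposed T S i q := by
  cases h <;> assumption

theorem Proposed.of_le {i : I} {q p : ℕ} (h : Proposed T S i q) (hp : p ≤ q) :
    Proposed T S i p := by
  induction hp with
  | refl => exact h
  | step _ ih => exact ih h.of_succ

variable (T S) in
/-- A set of proposals in which each proposal has its justification. -/
def SelfSupporting (F : Finset (I × ℕ)) : Prop :=
  ∀ i q, (i, q + 1) ∈ F → (i, q) ∈ F ∧ ∀ j k, T i q = S j k →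
    ∃ i' q' k', (i', q') ∈ F ∧ T i' q' = S j k' ∧ k < k'

theorem SelfSupporting.mem_of_le {F : Finset (I × ℕ)} (hF : SelfSupporting T S F) {i : I}
    {p q : ℕ} (h : (i, q) ∈ F) (hp : p ≤ q) : (i, p) ∈ F := by
  induction hp with
  | refl => exact h
  | step _ ih => exact ih (hF _ _ h).1

/-- A derivation mentions finitely many proposals. In a finite set each `S j` that is proposed to
has a furthest proposal, which the set of all proposals need not provide. -/
theorem Proposed.exists_selfSupporting [DecidableEq I]
    (hS : ∀ j j' k k', S j k = S j' k' → j = j' ∧ k = k') {i : I} {q : ℕ}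
    (h : Proposed T S i q) : ∃ F, SelfSupporting T S F ∧ (i, q) ∈ F := by
  induction h with
  | zero i =>
    refine ⟨{(i, 0)}, fun i' q' h => ?_, by simp⟩
    simp at h
  | @free i q _ hfree ih =>
    obtain ⟨F, hF, hi⟩ := ih
    refine ⟨insert (i, q + 1) F, fun i' q' h => ?_, by simp⟩
    rcases Finset.mem_insert.1 h with h | h
    · simp only [Prod.mk.injEq, Nat.add_right_cancel_iff] at h
      obtain ⟨rfl, rfl⟩ := h
      exact ⟨Finset.mem_insert_of_mem hi, fun j k hjk => absurd hjk (hfree j k)⟩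
    · obtain ⟨h₁, h₂⟩ := hF i' q' h
      refine ⟨Finset.mem_insert_of_mem h₁, fun j k hjk => ?_⟩
      obtain ⟨a, b, c, h₃, h₄⟩ := h₂ j k hjk
      exact ⟨a, b, c, Finset.mem_insert_of_mem h₃, h₄⟩
  | @rejected i i' q q' j k k' _ _ hk hk' hlt ih ih' =>
    obtain ⟨F, hF, hi⟩ := ih
    obtain ⟨F', hF', hi'⟩ := ih'
    refine ⟨insert (i, q + 1) (F ∪ F'), fun i₁ q₁ h => ?_, by simp⟩
    rcases Finset.mem_insert.1 h with h | h
    · simp only [Prod.mk.injEq, Nat.add_right_cancel_iff] at h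
      obtain ⟨rfl, rfl⟩ := h
      refine ⟨by simp [hi], fun j₁ k₁ hjk => ?_⟩
      obtain ⟨rfl, rfl⟩ := hS _ _ _ _ (hk.symm.trans hjk)
      exact ⟨i', q', k', by simp [hi'], hk', hlt⟩
    · rcases Finset.mem_union.1 h with h | h
      · obtain ⟨h₁, h₂⟩ := hF i₁ q₁ h
        refine ⟨by simp [h₁], fun j k hjk => ?_⟩
        obtain ⟨a, b, c, h₃, h₄⟩ := h₂ j k hjk
        exact ⟨a, b, c, by simp [h₃], h₄⟩
      · obtain ⟨h₁, h₂⟩ := hF' i₁ q₁ h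
        refine ⟨by simp [h₁], fun j k hjk => ?_⟩
        obtain ⟨a, b, c, h₃, h₄⟩ := h₂ j k hjk
        exact ⟨a, b, c, by simp [h₃], h₄⟩

/-- No more rays `S j` receive proposals than there are rays `T i`. -/
theorem card_le_of_forall_proposed [Fintype I]
    (hS : ∀ j j' k k', S j k = S j' k' → j = j' ∧ k = k') (F : Finset J)
    (hF : ∀ j ∈ F, ∃ i q k, Proposed T S i q ∧ T i q = S j k) : F.card ≤ Fintype.card I := by
  classical
  have hG : ∃ G, SelfSupporting T S G ∧ ∀ j ∈ F, ∃ i q k, (i, q) ∈ G ∧ T i q = S j k := by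
    induction F using Finset.induction_on with
    | empty => exact ⟨∅, by simp [SelfSupporting], by simp⟩
    | insert j F _ ih =>
      obtain ⟨G, hG, hGF⟩ := ih fun j hj => hF j (Finset.mem_insert_of_mem hj)
      obtain ⟨i, q, k, hP, hk⟩ := hF j (Finset.mem_insert_self _ _)
      obtain ⟨G', hG', hi⟩ := hP.exists_selfSupporting hS
      refine ⟨G ∪ G', fun i₁ q₁ h => ?_, fun j' hj' => ?_⟩
      · rcases Finset.mem_union.1 h with h | h
        · obtain ⟨h₁, h₂⟩ := hG i₁ q₁ h
          refine ⟨by simp [h₁], fun j k hjk => ?_⟩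
          obtain ⟨a, b, c, h₃, h₄⟩ := h₂ j k hjk
          exact ⟨a, b, c, by simp [h₃], h₄⟩
        · obtain ⟨h₁, h₂⟩ := hG' i₁ q₁ h
          refine ⟨by simp [h₁], fun j k hjk => ?_⟩
          obtain ⟨a, b, c, h₃, h₄⟩ := h₂ j k hjk
          exact ⟨a, b, c, by simp [h₃], h₄⟩
      · rcases Finset.mem_insert.1 hj' with rfl | hj'
        · exact ⟨i, q, k, by simp [hi], hk⟩
        · obtain ⟨a, b, c, h₁, h₂⟩ := hGF j' hj'
          exact ⟨a, b, c, by simp [h₁], h₂⟩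
  obtain ⟨G, hG, hGF⟩ := hG
  -- Take the proposal in `G` furthest along `S j`. If its maker went on within `G`, self-support
  -- would yield one still further. So it is the last of its maker in `G`, and distinct `j` have
  -- distinct makers.
  have hlast : ∀ j ∈ F, ∃ i q k, (i, q) ∈ G ∧ (i, q + 1) ∉ G ∧ T i q = S j k := by
    intro j hj
    obtain ⟨i₀, q₀, k₀, h₀, hk₀⟩ := hGF j hj
    let A := {x ∈ G | ∃ k, T x.1 x.2 = S j k}
    have hA : ∀ x : A, ∃ k, T x.1.1 x.1.2 = S j k := fun x => (Finset.mem_filter.1 x.2).2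
    choose κ hκ using hA
    obtain ⟨x, -, hx⟩ := Finset.exists_max_image (Finset.univ : Finset A) κ
      ⟨⟨(i₀, q₀), Finset.mem_filter.2 ⟨h₀, k₀, hk₀⟩⟩, Finset.mem_univ _⟩
    refine ⟨x.1.1, x.1.2, κ x, (Finset.mem_filter.1 x.2).1, fun hmem => ?_, hκ x⟩
    obtain ⟨i', q', k', h₁, h₂, h₃⟩ := (hG _ _ hmem).2 j _ (hκ x)
    have h₄ := hx ⟨(i', q'), Finset.mem_filter.2 ⟨h₁, k', h₂⟩⟩ (Finset.mem_univ _)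
    have h₅ := hκ ⟨(i', q'), Finset.mem_filter.2 ⟨h₁, k', h₂⟩⟩
    have := (hS _ _ _ _ (h₅.symm.trans h₂)).2
    omega
  rcases F.eq_empty_or_nonempty with rfl | ⟨j₀, hj₀⟩
  · simp
  have : Nonempty I := ⟨(hlast j₀ hj₀).choose⟩
  choose! ι q k h₁ h₂ h₃ using hlast
  refine Finset.card_le_card_of_injOn ι (by simp) fun j hj j' hj' hjj' => ?_
  have hle : ∀ a ∈ F, ∀ b ∈ F, ι a = ι b → q b ≤ q a := by
    intro a ha b hb hab
    by_contra! hlt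
    have := hG.mem_of_le (h₁ b hb) (Nat.succ_le_of_lt hlt)
    rw [← hab] at this
    exact h₂ a ha this
  have hq := le_antisymm (hle j' hj' j hj hjj'.symm) (hle j hj j' hj' hjj')
  have h := (h₃ j hj).symm
  rw [hjj', hq, h₃ j' hj'] at h
  exact (hS _ _ _ _ h).1

variable (T S) in
/-- The ray `t` follows `T i` up to the first unrejected proposal and then `S j`. -/
def IsRerouting (i : I) (t : ℕ → W) : Prop :=
  (∀ p, Proposed T S i p ∧ t p = T i p) ∨
    ∃ q j k, Proposed T S i q ∧ ¬ Proposed T S i (q + 1) ∧ T i q = S j k ∧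
      (∀ p ≤ q, t p = T i p) ∧ ∀ s, t (q + s) = S j (k + s)

theorem exists_isRerouting (i : I) : ∃ t, IsRerouting T S i t := by
  classical
  by_cases h : ∀ p, Proposed T S i p
  · exact ⟨T i, Or.inl fun p => ⟨h p, rfl⟩⟩
  · push Not at h
    let n := Nat.find h
    have hn : ¬ Proposed T S i n := Nat.find_spec h
    obtain ⟨q, hq⟩ : ∃ q, n = q + 1 := Nat.exists_eq_succ_of_ne_zero fun h0 => by
      rw [h0] at hn; exact hn (.zero i)
    have hPq : Proposed T S i q := by
      by_contra hh
      have : n ≤ q := Nat.find_min' h hh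
      omega
    rw [hq] at hn
    obtain ⟨j, k, hjk⟩ : ∃ j k, T i q = S j k := by
      by_contra! hh
      exact hn (hPq.free hh)
    refine ⟨fun p => if p ≤ q then T i p else S j (k + (p - q)), Or.inr ⟨q, j, k, hPq, hn, hjk,
      fun p hp => if_pos hp, fun s => ?_⟩⟩
    rcases Nat.eq_zero_or_pos s with rfl | hs
    · simp [hjk]
    · simp [show s ≠ 0 by omega]

theorem IsRerouting.apply {i : I} {t : ℕ → W} (ht : IsRerouting T S i t) (p : ℕ) :
    (Proposed T S i p ∧ t p = T i p) ∨ ∃ q j k s, Proposed T S i q ∧ ¬ Proposed T S i (q + 1) ∧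
      T i q = S j k ∧ 0 < s ∧ p = q + s ∧ t p = S j (k + s) := by
  rcases ht with ht | ⟨q, j, k, h₁, h₂, h₃, h₄, h₅⟩
  · exact Or.inl (ht p)
  · rcases le_or_gt p q with h | h
    · exact Or.inl ⟨h₁.of_le h, h₄ p h⟩
    · obtain ⟨s, rfl⟩ := Nat.exists_eq_add_of_lt h
      exact Or.inr ⟨q, j, k, s + 1, h₁, h₂, h₃, by omega, by omega, h₅ (s + 1)⟩

theorem IsRerouting.step {i : I} {t : ℕ → W} (ht : IsRerouting T S i t) (p : ℕ) :
    (t p = T i p ∧ t (p + 1) = T i (p + 1)) ∨ ∃ j k, t p = S j k ∧ t (p + 1) = S j (k + 1) := by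
  rcases ht with ht | ⟨q, j, k, h₁, h₂, h₃, h₄, h₅⟩
  · exact Or.inl ⟨(ht p).2, (ht (p + 1)).2⟩
  · rcases lt_or_ge p q with h | h
    · exact Or.inl ⟨h₄ p h.le, h₄ (p + 1) h⟩
    · obtain ⟨s, rfl⟩ := Nat.exists_eq_add_of_le h
      exact Or.inr ⟨j, k + s, h₅ s, h₅ (s + 1)⟩

theorem IsRerouting.apply_of_forall_ne {i : I} {t : ℕ → W} (ht : IsRerouting T S i t) {p : ℕ}
    (h : ∀ q < p, ∀ j k, T i q ≠ S j k) : t p = T i p := by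
  rcases ht.apply p with h' | ⟨q, j, k, s, _, _, h₃, h₄, h₅, _⟩
  · exact h'.2
  · exact absurd h₃ (h q (by omega) j k)

theorem IsRerouting.apply_mem {i : I} {t : ℕ → W} (ht : IsRerouting T S i t) (p : ℕ) :
    t p = T i p ∨ ∃ j k, t p = S j k := by
  rcases ht.step p with h | ⟨j, k, h, -⟩
  exacts [Or.inl h.1, Or.inr ⟨j, k, h⟩]

/-- A proposal on `S j` beyond an accepted one would have rejected it. So no ray still proposing
meets the part of `S j` in use, and two rays cannot settle at different places of the same `S j`. -/
theorem IsRerouting.disjoint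
    (hT : ∀ i i' p p', T i p = T i' p' → i = i' ∧ p = p')
    (hS : ∀ j j' k k', S j k = S j' k' → j = j' ∧ k = k') {t : I → ℕ → W}
    (ht : ∀ i, IsRerouting T S i (t i)) (i i' : I) (p p' : ℕ) (h : t i p = t i' p') :
    i = i' ∧ p = p' := by
  have key : ∀ i i' p q' j' k' s', Proposed T S i p → Proposed T S i' q' →
      ¬ Proposed T S i' (q' + 1) → T i' q' = S j' k' → 0 < s' → T i p ≠ S j' (k' + s') :=
    fun i i' p q' j' k' s' h₁ h₂ h₃ h₄ h₅ h₆ => h₃ (h₂.rejected h₁ h₄ h₆ (by omega))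
  rcases (ht i).apply p with ⟨h₁, h₂⟩ | ⟨q, j, k, s, h₁, h₂, h₃, h₄, h₅, h₆⟩ <;>
  rcases (ht i').apply p' with ⟨h₁', h₂'⟩ | ⟨q', j', k', s', h₁', h₂', h₃', h₄', h₅', h₆'⟩
  · exact hT _ _ _ _ (by rw [← h₂, h, h₂'])
  · exact absurd (by rw [← h₂, h, h₆']) (key i i' p q' j' k' s' h₁ h₁' h₂' h₃' h₄')
  · exact absurd (by rw [← h₂', ← h, h₆]) (key i' i p' q j k s h₁' h₁ h₂ h₃ h₄)
  · obtain ⟨rfl, hks⟩ := hS j j' (k + s) (k' + s') (by rw [← h₆, h, h₆'])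
    have hk : k = k' := by
      rcases lt_trichotomy k k' with hlt | heq | hlt
      · exact absurd (h₁.rejected h₁' h₃ h₃' hlt) h₂
      · exact heq
      · exact absurd (h₁'.rejected h₁ h₃' h₃ hlt) h₂'
    subst hk
    obtain ⟨rfl, rfl⟩ := hT _ _ _ _ (h₃.trans h₃'.symm)
    exact ⟨rfl, by omega⟩

/-- Disjoint rays `T i` can be rerouted along disjoint rays `S j` so that they stay disjoint and
meet at most as many of the `S j` as there are rays `T i`. -/
theorem exists_rerouting [Fintype I]
    (hT : ∀ i i' p p', T i p = T i' p' → i = i' ∧ p = p')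
    (hS : ∀ j j' k k', S j k = S j' k' → j = j' ∧ k = k') :
    ∃ (t : I → ℕ → W) (A : Set J), (∀ i, IsRerouting T S i (t i)) ∧
      (∀ i i' p p', t i p = t i' p' → i = i' ∧ p = p') ∧
      (∀ F : Finset J, (F : Set J) ⊆ A → F.card ≤ Fintype.card I) ∧
      ∀ i p j k, t i p = S j k → j ∈ A := by
  choose t ht using fun i => exists_isRerouting (T := T) (S := S) i
  refine ⟨t, {j | ∃ i q k, Proposed T S i q ∧ T i q = S j k}, ht, IsRerouting.disjoint hT hS ht,
    fun F hF => card_le_of_forall_proposed hS F fun j hj => hF hj, fun i p j k h => ?_⟩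
  rcases (ht i).apply p with ⟨h₁, h₂⟩ | ⟨q, j', k', s, h₁, _, h₃, _, _, h₆⟩
  · exact ⟨i, p, k, h₁, h₂.symm.trans h⟩
  · obtain ⟨rfl, -⟩ := hS _ _ _ _ (h.symm.trans h₆)
    exact ⟨i, q, k', h₁, h₃⟩

end Reroute

/-! ### Ubiquity when both ends are of the same kind -/

section OutTails

variable {W : Type*}

/-- The tail of the double ray `f` to the right of `L` or to the left of `-L`. -/
def tail (L : ℕ) (f : ℤ → W) (s : Bool) (p : ℕ) : W :=
  if s then f (L + 1 + p) else f (-(L + 1 + p))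

theorem tail_mem (L : ℕ) (f : ℤ → W) (s : Bool) (p : ℕ) :
    ∃ z : ℤ, |z| = L + 1 + p ∧ tail L f s p = f z := by
  cases s
  · exact ⟨-(L + 1 + p), by rw [abs_neg, abs_of_nonneg (by positivity)], by simp [tail]⟩
  · exact ⟨L + 1 + p, by rw [abs_of_nonneg (by positivity)], by simp [tail]⟩

theorem tail_injective {L : ℕ} {f : ℤ → W} (hf : Function.Injective f) {s s' : Bool} {p p' : ℕ}
    (h : tail L f s p = tail L f s' p') : s = s' ∧ p = p' := by
  cases s <;> cases s' <;> simp only [tail, Bool.false_eq_true, if_false, if_true] at h <;>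
    have := hf h <;> simp <;> omega

variable {D : Digraph W} {d : ℤ → Bool} {L : ℕ}

theorem Follows.adj_tail {f : ℤ → W} (hf : D.Follows d f) (hr : ∀ i : ℤ, L ≤ i → d i = true)
    (hl : ∀ i : ℤ, i < -L → d i = false) (s : Bool) (p : ℕ) :
    D.Adj (tail L f s p) (tail L f s (p + 1)) := by
  cases s
  · have := (hf (-(L + 1 + (p + 1 : ℕ)))).2 (hl _ (by push_cast; omega))
    simp only [tail, Bool.false_eq_true, if_false]
    convert this using 2
    push_cast
    ring
  · have := (hf (L + 1 + p)).1 (hr _ (by omega))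
    simp only [tail, if_true]
    convert this using 2
    push_cast
    ring

variable (D d L) in
/-- The first `n` of the double rays `g i` are copies which are disjoint except that the tails of
earlier ones may meet the cores of later ones. -/
def AlmostDisjoint (n : ℕ) (g : ℕ → ℤ → W) : Prop :=
  (∀ i < n, Function.Injective (g i) ∧ D.Follows d (g i)) ∧
    ∀ i i', i < i' → i' < n → ∀ z z', g i z = g i' z' → (L : ℤ) < |z| ∧ |z'| ≤ L

/-- Among many disjoint sets, many avoid a given finite set. -/
theorem exists_finset_avoiding {k : ℕ} (c : Fin k → ℤ → W)
    (hc : ∀ i j x y, c i x = c j y → i = j) (X : Finset W) (n : ℕ) (hk : X.card + n ≤ k) :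
    ∃ J : Finset (Fin k), n ≤ J.card ∧ ∀ j ∈ J, ∀ z, c j z ∉ X := by
  classical
  let B : Finset (Fin k) := Finset.univ.filter fun j => ∃ z, c j z ∈ X
  have hB : ∀ j : B, ∃ z, c j z ∈ X := fun j => (Finset.mem_filter.1 j.2).2
  choose ζ hζ using hB
  have hcard : B.card ≤ X.card := by
    rw [← Fintype.card_coe B, ← Fintype.card_coe X]
    refine Fintype.card_le_of_injective (fun j => (⟨c j (ζ j), hζ j⟩ : X)) fun j j' h => ?_
    exact Subtype.ext (hc _ _ _ _ (congrArg Subtype.val h))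
  refine ⟨Bᶜ, ?_, fun j hj z hz => ?_⟩
  · rw [Finset.card_compl, Fintype.card_fin]
    omega
  · exact Finset.mem_compl.1 hj (Finset.mem_filter.2 ⟨Finset.mem_univ _, z, hz⟩)

/-- Replace the tails of a double ray. -/
def withTails (L : ℕ) (f : ℤ → W) (t : Bool → ℕ → W) (z : ℤ) : W :=
  if (L : ℤ) < |z| then t (decide (0 ≤ z)) (|z| - L - 1).toNat else f z

theorem withTails_of_le {f : ℤ → W} {t : Bool → ℕ → W} {z : ℤ} (hz : |z| ≤ L) :
    withTails L f t z = f z := if_neg (not_lt.2 hz)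

theorem withTails_of_lt {f : ℤ → W} {t : Bool → ℕ → W} {z : ℤ} (hz : (L : ℤ) < |z|) :
    withTails L f t z = t (decide (0 ≤ z)) (|z| - L - 1).toNat := if_pos hz

theorem tail_decide {f : ℤ → W} {z : ℤ} (hz : (L : ℤ) < |z|) :
    tail L f (decide (0 ≤ z)) (|z| - L - 1).toNat = f z := by
  rcases le_or_gt 0 z with h | h
  · rw [abs_of_nonneg h] at *
    simp only [tail, h, decide_true, if_true]
    congr 1
    omega
  · rw [abs_of_neg h] at *
    simp only [tail, not_le.2 h, decide_false, Bool.false_eq_true, if_false]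
    congr 1
    omega

theorem follows_withTails {f : ℤ → W} (hf : D.Follows d f) (hr : ∀ i : ℤ, L ≤ i → d i = true)
    (hl : ∀ i : ℤ, i < -L → d i = false) {t : Bool → ℕ → W}
    (h0 : ∀ s, t s 0 = tail L f s 0) (ht : ∀ s p, D.Adj (t s p) (t s (p + 1))) :
    D.Follows d (withTails L f t) := by
  intro i
  have hpos : ∀ p : ℕ, withTails L f t (L + 1 + p) = t true p := fun p => by
    have h : |(L + 1 + p : ℤ)| = L + 1 + p := abs_of_nonneg (by positivity)
    rw [withTails_of_lt (by rw [h]; omega), h, decide_eq_true (by positivity)]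
    congr 1
    omega
  have hneg : ∀ p : ℕ, withTails L f t (-(L + 1 + p)) = t false p := fun p => by
    have h : |(-(L + 1 + p) : ℤ)| = L + 1 + p := by rw [abs_neg, abs_of_nonneg (by positivity)]
    rw [withTails_of_lt (by rw [h]; omega), h, decide_eq_false (by omega)]
    congr 1
    omega
  have hcore : ∀ z : ℤ, |z| ≤ L + 1 → withTails L f t z = f z := fun z hz => by
    rcases le_or_gt |z| L with h | h
    · exact withTails_of_le h
    · have : |z| - L - 1 = 0 := by omega
      rw [withTails_of_lt h, this, Int.toNat_zero, h0, ← tail_decide (f := f) h, this,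
        Int.toNat_zero]
  rcases le_or_gt (L + 1 : ℤ) i with h | h
  · obtain ⟨p, rfl⟩ := Int.le.dest h
    rw [hr _ (by omega), hpos, show (L + 1 + p + 1 : ℤ) = L + 1 + (p + 1 : ℕ) by push_cast; ring,
      hpos]
    simp [ht]
  rcases lt_or_ge i (-(L + 1) : ℤ) with h' | h'
  · obtain ⟨p, hp⟩ := Int.le.dest (show i + 1 ≤ -(L + 1) by omega)
    obtain rfl : i = -(L + 1 + (p + 1 : ℕ)) := by push_cast; omega
    rw [hl _ (by omega), hneg,
      show (-(L + 1 + (p + 1 : ℕ)) + 1 : ℤ) = -(L + 1 + p) by push_cast; ring, hneg]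
    simp [ht]
  · rw [hcore i (abs_le.2 ⟨by omega, by omega⟩), hcore (i + 1) (abs_le.2 ⟨by omega, by omega⟩)]
    exact hf i

/-- Both ends are out-rays, so rerouting may mix left and right tails. Freezing everything up to
distance `K` makes the iteration converge. -/
theorem AlmostDisjoint.exists_succ (hr : ∀ i : ℤ, L ≤ i → d i = true)
    (hl : ∀ i : ℤ, i < -L → d i = false)
    (hD : ∀ k : ℕ, ∃ f : Fin k → ℤ → W, (∀ i, Function.Injective (f i)) ∧
      (∀ i, D.Follows d (f i)) ∧ ∀ i j x y, f i x = f j y → i = j)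
    {n : ℕ} {g : ℕ → ℤ → W} (hg : AlmostDisjoint D d L n g) (K : ℕ) (hK : L ≤ K) :
    ∃ g', AlmostDisjoint D d L (n + 1) g' ∧ ∀ i < n, ∀ z : ℤ, |z| ≤ K → g' i z = g i z := by
  classical
  obtain ⟨hg₁, hg₂⟩ := hg
  let X : Finset W := (Finset.range n ×ˢ Finset.Icc (-K : ℤ) K).image fun x => g x.1 x.2
  have hX : ∀ i < n, ∀ z : ℤ, |z| ≤ K → g i z ∈ X := fun i hi z hz =>
    Finset.mem_image.2 ⟨(i, z), by
      rw [abs_le] at hz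
      simp [hi, hz.1, hz.2], rfl⟩
  obtain ⟨c, hc₁, hc₂, hc₃⟩ := hD (X.card + (2 * n + 1))
  obtain ⟨J, hJ, hJX⟩ := exists_finset_avoiding c hc₃ X (2 * n + 1) le_rfl
  let T : Fin n × Bool → ℕ → W := fun i => tail L (g i.1) i.2
  let S : J × Bool → ℕ → W := fun j => tail L (c j.1) j.2
  have hSX : ∀ j k, S j k ∉ X := fun j k h => by
    obtain ⟨z, -, hz⟩ := tail_mem L (c j.1) j.2 k
    exact hJX j.1 j.1.2 z (hz ▸ h)
  have hT : ∀ i i' p p', T i p = T i' p' → i = i' ∧ p = p' := by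
    rintro ⟨i, s⟩ ⟨i', s'⟩ p p' h
    obtain ⟨z, hz, hz'⟩ := tail_mem L (g i) s p
    obtain ⟨y, hy, hy'⟩ := tail_mem L (g i') s' p'
    have hzy : g i z = g i' y := by rw [← hz', ← hy']; exact h
    have hii : i = i' := by
      rcases lt_trichotomy i i' with hlt | heq | hlt
      · have := (hg₂ i i' hlt i'.2 _ _ hzy).2
        omega
      · exact heq
      · have := (hg₂ i' i hlt i.2 _ _ hzy.symm).2
        omega
    subst hii
    obtain ⟨rfl, rfl⟩ := tail_injective (hg₁ i i.2).1 h
    exact ⟨rfl, rfl⟩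
  have hS : ∀ j j' k k', S j k = S j' k' → j = j' ∧ k = k' := by
    rintro ⟨j, s⟩ ⟨j', s'⟩ k k' h
    obtain ⟨z, hz, hz'⟩ := tail_mem L (c j) s k
    obtain ⟨y, hy, hy'⟩ := tail_mem L (c j') s' k'
    obtain rfl : j = j' := Subtype.ext (hc₃ _ _ z y (by rw [← hz', ← hy']; exact h))
    obtain ⟨rfl, rfl⟩ := tail_injective (hc₁ j) h
    exact ⟨rfl, rfl⟩
  obtain ⟨t, A, ht, htinj, hA, htA⟩ := exists_rerouting hT hS
  obtain ⟨j, hj⟩ : ∃ j : J, ∀ s, (j, s) ∉ A := by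
    by_contra! h
    choose s hs using h
    have := hA (Finset.univ.image fun j => (j, s j)) (by
      intro x hx
      obtain ⟨j, -, rfl⟩ := Finset.mem_image.1 (Finset.mem_coe.1 hx)
      exact hs j)
    rw [Finset.card_image_of_injective _ fun a b h => congrArg Prod.fst h, Finset.card_univ,
      Fintype.card_coe, Fintype.card_prod, Fintype.card_fin, Fintype.card_bool] at this
    omega
  -- A ray leaves `T i` only after a vertex on some `S j`, and no such vertex is in `X`. So even the
  -- vertex at distance `K + 1` is unchanged, which joins core and new tail when `K = L`.
  have htK : ∀ i (p : ℕ), (L + 1 + p : ℤ) ≤ K + 1 → t i p = T i p := fun i p hp =>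
    (ht i).apply_of_forall_ne fun q hq j k h => hSX j k <| by
      obtain ⟨z, hz, hz'⟩ := tail_mem L (g i.1) i.2 q
      rw [← h]
      change tail L (g i.1) i.2 q ∈ X
      rw [hz']
      exact hX _ i.1.2 _ (by omega)
  have ht_adj : ∀ i p, D.Adj (t i p) (t i (p + 1)) := fun i p => by
    rcases (ht i).step p with ⟨h₁, h₂⟩ | ⟨j, k, h₁, h₂⟩
    · rw [h₁, h₂]
      exact (hg₁ i.1 i.1.2).2.adj_tail hr hl _ _
    · rw [h₁, h₂]
      exact (hc₂ j.1).adj_tail hr hl _ _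
  let h : Fin n → ℤ → W := fun i => withTails L (g i) fun s => t (i, s)
  have h_core : ∀ i (z : ℤ), |z| ≤ L → h i z = g i z := fun i z hz => withTails_of_le hz
  have h_tail : ∀ i (z : ℤ), (L : ℤ) < |z| →
      h i z = t (i, decide (0 ≤ z)) (|z| - L - 1).toNat := fun i z hz => withTails_of_lt hz
  have h_mem : ∀ i (z : ℤ), h i z = g i z ∨ ∃ j k, h i z = S j k := fun i z => by
    rcases le_or_gt |z| L with hz | hz
    · exact Or.inl (h_core i z hz)
    · rw [h_tail i z hz]
      rcases (ht (i, decide (0 ≤ z))).apply_mem (|z| - L - 1).toNat with h' | h'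
      · left
        rw [h']
        exact tail_decide hz
      · exact Or.inr h'
  have h_tail_inj : ∀ i i' (z z' : ℤ), (L : ℤ) < |z| → (L : ℤ) < |z'| → h i z = h i' z' →
      i = i' ∧ z = z' := by
    intro i i' z z' hz hz' heq
    rw [h_tail i z hz, h_tail i' z' hz'] at heq
    obtain ⟨h₁, h₂⟩ := htinj _ _ _ _ heq
    simp only [Prod.mk.injEq, decide_eq_decide] at h₁
    refine ⟨h₁.1, ?_⟩
    have h₃ : |z| = |z'| := by omega
    rcases abs_eq_abs.1 h₃ with h₄ | h₄
    · exact h₄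
    · have := h₁.2
      have : z ≠ 0 := by rintro rfl; simp at hz; omega
      omega
  have h_core_ne : ∀ i (z : ℤ), |z| ≤ L → ∀ j k, h i z ≠ S j k := fun i z hz j k heq =>
    hSX j k (by rw [← heq, h_core i z hz]; exact hX i i.2 z (by omega))
  have h_core_eq : ∀ i i' (z z' : ℤ), |z| ≤ L → h i z = h i' z' → g i z = g i' z' := by
    intro i i' z z' hz heq
    rcases h_mem i' z' with h' | ⟨j, k, h'⟩
    · rw [← h', ← heq, h_core i z hz]
    · exact absurd (heq.trans h') (h_core_ne i z hz j k)
  have h_new : ∀ i (z z' : ℤ), h i z = c j z' → (L : ℤ) < |z| ∧ |z'| ≤ L := by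
    intro i z z' heq
    have hz : (L : ℤ) < |z| := by
      by_contra! hz
      refine hJX j j.2 z' ?_
      rw [← heq, h_core i z hz]
      exact hX i i.2 z (by omega)
    refine ⟨hz, ?_⟩
    by_contra! hz'
    rw [h_tail i z hz, ← tail_decide (f := c j) hz'] at heq
    exact hj _ (htA _ _ (j, decide (0 ≤ z')) _ heq)
  have hh : ∀ i : Fin n, Function.Injective (h i) ∧ D.Follows d (h i) := by
    refine fun i => ⟨fun z z' heq => ?_, ?_⟩
    · rcases le_or_gt |z| L with hz | hz
      · exact (hg₁ i i.2).1 (h_core_eq i i z z' hz heq)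
      rcases le_or_gt |z'| L with hz' | hz'
      · exact ((hg₁ i i.2).1 (h_core_eq i i z' z hz' heq.symm)).symm
      · exact (h_tail_inj i i z z' hz hz' heq).2
    · exact follows_withTails (hg₁ i i.2).2 hr hl (fun s => htK (i, s) 0 (by push_cast; omega))
        fun s p => ht_adj (i, s) p
  let g' : ℕ → ℤ → W := fun i => if hi : i < n then h ⟨i, hi⟩ else c j
  have hg'_lt : ∀ i (hi : i < n), g' i = h ⟨i, hi⟩ := fun i hi => dif_pos hi
  have hg'_n : g' n = c j := dif_neg (lt_irrefl n)
  refine ⟨g', ⟨fun i hi => ?_, fun i i' hlt hi' z z' heq => ?_⟩, fun i hi z hz => ?_⟩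
  · rcases Nat.lt_succ_iff_lt_or_eq.1 hi with hi | rfl
    · rw [hg'_lt i hi]
      exact hh _
    · rw [hg'_n]
      exact ⟨hc₁ j, hc₂ j⟩
  · rcases Nat.lt_succ_iff_lt_or_eq.1 hi' with hi' | rfl
    · rw [hg'_lt i (hlt.trans hi'), hg'_lt i' hi'] at heq
      have hz : (L : ℤ) < |z| := by
        by_contra! hz
        exact not_lt_of_ge hz (hg₂ i i' hlt hi' _ _ (h_core_eq _ _ _ _ hz heq)).1
      refine ⟨hz, ?_⟩
      by_contra! hz'
      have := (h_tail_inj _ _ _ _ hz hz' heq).1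
      simp only [Fin.mk.injEq] at this
      omega
    · rw [hg'_lt i hlt, hg'_n] at heq
      exact h_new _ _ _ heq
  · rw [hg'_lt i hi]
    rcases le_or_gt |z| L with hz' | hz'
    · exact h_core _ _ hz'
    · rw [h_tail _ _ hz', htK _ (|z| - L - 1).toNat (by omega)]
      exact tail_decide hz'

/-- Infinitely many copies that are disjoint except that the tails of earlier ones may meet the
cores of later ones. -/
theorem exists_forall_almostDisjoint (hr : ∀ i : ℤ, L ≤ i → d i = true)
    (hl : ∀ i : ℤ, i < -L → d i = false)
    (hD : ∀ k : ℕ, ∃ f : Fin k → ℤ → W, (∀ i, Function.Injective (f i)) ∧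
      (∀ i, D.Follows d (f i)) ∧ ∀ i j x y, f i x = f j y → i = j) :
    ∃ g, ∀ n, AlmostDisjoint D d L n g := by
  classical
  obtain ⟨f₀, -⟩ := hD 1
  let start : {g : ℕ → ℤ → W // AlmostDisjoint D d L 0 g} :=
    ⟨fun _ => f₀ 0, fun i hi => absurd hi (by omega), fun i i' _ hi => absurd hi (by omega)⟩
  have hstep : ∀ n (g : {g : ℕ → ℤ → W // AlmostDisjoint D d L n g}),
      ∃ g' : {g : ℕ → ℤ → W // AlmostDisjoint D d L (n + 1) g},
        ∀ i < n, ∀ z : ℤ, |z| ≤ (n + L : ℕ) → g'.1 i z = g.1 i z := fun n g => by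
    obtain ⟨g', h₁, h₂⟩ := g.2.exists_succ hr hl hD (n + L) (by omega)
    exact ⟨⟨g', h₁⟩, h₂⟩
  choose next hnext using hstep
  let G : ∀ n, {g : ℕ → ℤ → W // AlmostDisjoint D d L n g} := fun n => Nat.rec start next n
  have hG : ∀ n, ∀ i < n, ∀ z : ℤ, |z| ≤ (n + L : ℕ) → (G (n + 1)).1 i z = (G n).1 i z :=
    fun n => hnext n (G n)
  have hstable : ∀ (i : ℕ) (z : ℤ) (n m : ℕ), n ≤ m → i < n → |z| ≤ n → (G m).1 i z = (G n).1 i z := by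
    intro i z n m hnm hi hz
    induction m, hnm using Nat.le_induction with
    | base => rfl
    | succ m hm ih => rw [hG m i (by omega) z (by push_cast; omega), ih]
  -- From stage `i + 1 + z.natAbs` on, the value at `z` is frozen.
  let g : ℕ → ℤ → W := fun i z => (G (i + 1 + z.natAbs)).1 i z
  have hg : ∀ (i : ℕ) (z : ℤ) (n : ℕ), i < n → z.natAbs ≤ n → g i z = (G n).1 i z := by
    intro i z n hi hz
    rw [← hstable i z n (i + 1 + z.natAbs + n) (by omega) hi (by rw [Int.abs_eq_natAbs]; omega)]
    exact (hstable i z _ _ (by omega) (by omega) (by push_cast; omega)).symm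
  refine ⟨g, fun n => ⟨fun i _ => ⟨fun z z' h => ?_, fun z => ?_⟩, fun i i' hlt _ z z' h => ?_⟩⟩
  · let m := i + 1 + z.natAbs + z'.natAbs
    rw [hg i z m (by omega) (by omega), hg i z' m (by omega) (by omega)] at h
    exact ((G m).2.1 i (by omega)).1 h
  · let m := i + 1 + z.natAbs + (z + 1).natAbs
    rw [hg i z m (by omega) (by omega), hg i (z + 1) m (by omega) (by omega)]
    exact ((G m).2.1 i (by omega)).2 z
  · let m := i' + 1 + z.natAbs + z'.natAbs
    rw [hg i z m (by omega) (by omega), hg i' z' m (by omega) (by omega)] at h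
    exact (G m).2.2 i i' hlt (by omega) z z' h

end OutTails

/-- A graph on `ℕ` in which each vertex has at most `M` smaller neighbours has an infinite
independent set. -/
theorem exists_strictMono_of_card_lt {r : ℕ → ℕ → Prop} {M : ℕ}
    (h : ∀ n, ∀ F : Finset ℕ, (∀ i ∈ F, i < n ∧ r i n) → F.card ≤ M) :
    ∃ φ : ℕ → ℕ, StrictMono φ ∧ ∀ i j, i < j → ¬ r (φ i) (φ j) := by
  classical
  -- Greedy colouring: the smaller neighbours forbid at most `M` of the `M + 1` colours.
  have hcol : ∀ n (c : ∀ m, m < n → Fin (M + 1)),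
      ∃ x : Fin (M + 1), ∀ m (hm : m < n), r m n → c m hm ≠ x := by
    intro n c
    by_contra! hc
    choose m hm hr hx using hc
    have := h n (Finset.univ.image m) fun i hi => by
      obtain ⟨x, -, rfl⟩ := Finset.mem_image.1 hi
      exact ⟨hm x, hr x⟩
    rw [Finset.card_image_of_injective, Finset.card_univ, Fintype.card_fin] at this
    · omega
    · intro x y hxy
      rw [← hx x, ← hx y]
      congr 1
  choose F hF using hcol
  let c : ℕ → Fin (M + 1) := Nat.lt_wfRel.wf.fix F
  have hc : ∀ m n, m < n → r m n → c m ≠ c n := by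
    intro m n hmn hr
    have := hF n (fun m _ => c m) m hmn hr
    rwa [show c n = F n fun m _ => c m from Nat.lt_wfRel.wf.fix_eq F n]
  obtain ⟨x, hx⟩ := Finite.exists_infinite_fiber c
  have hx' : (c ⁻¹' {x}).Infinite := Set.infinite_coe_iff.1 hx
  refine ⟨Nat.nth (· ∈ c ⁻¹' {x}), Nat.nth_strictMono hx', fun i j hij hr => ?_⟩
  have h₁ : c _ = x := Nat.nth_mem_of_infinite hx' i
  have h₂ : c _ = x := Nat.nth_mem_of_infinite hx' j
  exact hc _ _ (Nat.nth_strictMono hx' hij) hr (h₁.trans h₂.symm)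

/-- In the limit family, an earlier copy meets a later one only in the core of the latter, and with
its own tail. Tails of different copies are disjoint, so different earlier copies use different core
vertices, and there are at most `2L + 1` of them. -/
theorem exists_infinite_disjoint_of_outTails {W : Type*} {D : Digraph W} {d : ℤ → Bool} {L : ℕ}
    (hr : ∀ i : ℤ, L ≤ i → d i = true) (hl : ∀ i : ℤ, i < -L → d i = false)
    (hD : ∀ k : ℕ, ∃ f : Fin k → ℤ → W, (∀ i, Function.Injective (f i)) ∧
      (∀ i, D.Follows d (f i)) ∧ ∀ i j x y, f i x = f j y → i = j) :
    ∃ f : ℕ → ℤ → W, (∀ i, Function.Injective (f i)) ∧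
      (∀ i, D.Follows d (f i)) ∧ ∀ i j x y, f i x = f j y → i = j := by
  classical
  obtain ⟨g, hg⟩ := exists_forall_almostDisjoint hr hl hD
  have hmeet : ∀ i i', i < i' → ∀ z z', g i z = g i' z' → (L : ℤ) < |z| ∧ |z'| ≤ L :=
    fun i i' hlt => (hg (i' + 1)).2 i i' hlt (by omega)
  obtain ⟨φ, hφ, hdis⟩ := exists_strictMono_of_card_lt (r := fun i i' => ∃ z z', g i z = g i' z')
    (M := (Finset.Icc (-L : ℤ) L).card) fun n F hF => by
      have hF' : ∀ i : F, ∃ z z', g i z = g n z' := fun i => (hF i i.2).2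
      choose z z' hz using hF'
      have hz' : ∀ i : F, z' i ∈ Finset.Icc (-L : ℤ) L := fun i => by
        have := (hmeet i n (hF i i.2).1 _ _ (hz i)).2
        exact Finset.mem_Icc.2 (abs_le.1 this)
      rw [← Fintype.card_coe F, ← Fintype.card_coe (Finset.Icc (-L : ℤ) L)]
      refine Fintype.card_le_of_injective (fun i => ⟨z' i, hz' i⟩) fun i j hij => ?_
      have heq : g i (z i) = g j (z j) := by
        rw [hz i, hz j]
        congr 1
        exact congrArg Subtype.val hij
      have hi := (hmeet i n (hF i i.2).1 _ _ (hz i)).1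
      have hj := (hmeet j n (hF j j.2).1 _ _ (hz j)).1
      rcases lt_trichotomy (i : ℕ) j with hlt | h | hlt
      · have := (hmeet i j hlt _ _ heq).2
        omega
      · exact Subtype.ext h
      · have := (hmeet j i hlt _ _ heq.symm).2
        omega
  refine ⟨fun i => g (φ i), fun i => ((hg (φ i + 1)).1 _ (by omega)).1,
    fun i => ((hg (φ i + 1)).1 _ (by omega)).2, fun i j x y h => ?_⟩
  rcases lt_trichotomy i j with hlt | h' | hlt
  · exact absurd ⟨x, y, h⟩ (hdis i j hlt)
  · exact h'
  · exact absurd ⟨y, x, h.symm⟩ (hdis j i hlt)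

/-- An oriented double ray both of whose ends are out-rays, or both of whose ends are in-rays, is
ubiquitous. -/
theorem IsWord.isUbiquitous {V : Type u} {R : Digraph V} {e : ℤ ≃ V} {d : ℤ → Bool}
    (h : R.IsWord e d) {N : ℕ} {b : Bool} (hr : ∀ i : ℤ, N ≤ i → d i = b)
    (hl : ∀ i : ℤ, i ≤ -N → d i = !b) : IsUbiquitous.{u, v} R := by
  intro W D hD
  simp only [h.hasDisjointCopies_iff] at hD ⊢
  cases b
  · have hrev : ∀ f : ℤ → W, D.Follows d f ↔ (⟨fun x y => D.Adj y x⟩ : Digraph W).Follows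
        (fun i => !d i) f := fun f => by
      simp only [Follows, Bool.not_eq_true', Bool.not_eq_false']
      exact forall_congr' fun i => and_comm
    simp only [hrev] at hD ⊢
    exact exists_infinite_disjoint_of_outTails (L := N) (fun i hi => by simp [hr i hi])
      (fun i hi => by simp [hl i hi.le]) hD
  · exact exists_infinite_disjoint_of_outTails (L := N) hr (fun i hi => by simp [hl i hi.le]) hD

/-! ### The grid: one end an in-ray, the other an out-ray -/

section Grid

/-- The abscissa of the column number `c` of the grid. -/
def colX (m : ℕ) (c : ℕ) : ℤ := 2 * m * c

/-- The height of the row number `r` of the grid. -/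
def rowY (m : ℕ) (r : ℕ) : ℤ := m * (r + 1)

/-- The double ray number `n` in the grid: it comes down its column, and continues below height `0`
until it jumps to the start of its row, which it follows to the right. -/
def gridRay (m : ℕ) (α β : ℤ) (n : ℕ) (z : ℤ) : ℤ × ℤ :=
  if z < β then (colX m n, α - z) else (colX m (2 * n) + m + (z - β), rowY m n)

/-- The union of copies of the double ray with word `d` along the double rays `gridRay m α β n`. -/
def grid (d : ℤ → Bool) (m : ℕ) (α β : ℤ) : Digraph (ℤ × ℤ) where
  Adj p q := ∃ n z,
    (d z = true ∧ p = gridRay m α β n z ∧ q = gridRay m α β n (z + 1)) ∨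
    (d z = false ∧ p = gridRay m α β n (z + 1) ∧ q = gridRay m α β n z)

theorem colX_trichotomy (m c c' : ℕ) :
    (c < c' ∧ colX m c + 2 * m ≤ colX m c') ∨ (c = c' ∧ colX m c = colX m c') ∨
      (c' < c ∧ colX m c' + 2 * m ≤ colX m c) := by
  have key : ∀ a b : ℕ, a < b → colX m a + 2 * m ≤ colX m b := fun a b h => by
    obtain ⟨t, rfl⟩ := Nat.exists_eq_add_of_lt h
    simp only [colX]
    push_cast
    nlinarith [show (0 : ℤ) ≤ m * t by positivity]
  rcases lt_trichotomy c c' with h | rfl | h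
  · exact Or.inl ⟨h, key _ _ h⟩
  · exact Or.inr (Or.inl ⟨rfl, rfl⟩)
  · exact Or.inr (Or.inr ⟨h, key _ _ h⟩)

theorem rowY_trichotomy (m r r' : ℕ) :
    (r < r' ∧ rowY m r + m ≤ rowY m r') ∨ (r = r' ∧ rowY m r = rowY m r') ∨
      (r' < r ∧ rowY m r' + m ≤ rowY m r) := by
  have key : ∀ a b : ℕ, a < b → rowY m a + m ≤ rowY m b := fun a b h => by
    obtain ⟨t, rfl⟩ := Nat.exists_eq_add_of_lt h
    simp only [rowY]
    push_cast
    nlinarith [show (0 : ℤ) ≤ m * t by positivity]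
  rcases lt_trichotomy r r' with h | rfl | h
  · exact Or.inl ⟨h, key _ _ h⟩
  · exact Or.inr (Or.inl ⟨rfl, rfl⟩)
  · exact Or.inr (Or.inr ⟨h, key _ _ h⟩)

theorem colX_nonneg (m c : ℕ) : 0 ≤ colX m c := by unfold colX; positivity

theorem le_rowY (m r : ℕ) : (m : ℤ) ≤ rowY m r := by
  unfold rowY
  nlinarith [show (0 : ℤ) ≤ m * r by positivity]

variable {d : ℤ → Bool} {m : ℕ} {α β : ℤ}

/-- Column `n'` crosses row `n` only if `n' > 2 * n`, by the place where the row starts. -/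
theorem gridRay_eq (hm : 0 < m) {n n' : ℕ} (h₁ : n ≤ 2 * n') (h₂ : n' ≤ 2 * n) {z z' : ℤ}
    (h : gridRay m α β n z = gridRay m α β n' z') : n = n' ∧ z = z' := by
  unfold gridRay at h
  have := colX_trichotomy m n n'
  have := colX_trichotomy m n (2 * n')
  have := colX_trichotomy m n' (2 * n)
  have := rowY_trichotomy m n n'
  split_ifs at h <;> simp only [Prod.mk.injEq] at h
  · omega
  · omega
  · omega
  · obtain rfl : n = n' := by omega
    omega

/-- An arc of the grid down a column. -/
def IsColArc (m : ℕ) (p q : ℤ × ℤ) : Prop :=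
  ∃ c, p.1 = colX m c ∧ q.1 = p.1 ∧ q.2 = p.2 - 1 ∧ 1 ≤ p.2

/-- An arc of the grid to the right along a row. -/
def IsRowArc (m : ℕ) (p q : ℤ × ℤ) : Prop :=
  ∃ r, p.2 = rowY m r ∧ q.2 = p.2 ∧ q.1 = p.1 + 1 ∧ colX m (2 * r) + m ≤ p.1

/-- An arc between the first and the last turn of one of the double rays forming the grid. -/
def IsCoreArc (m : ℕ) (α β : ℤ) (p q : ℤ × ℤ) : Prop :=
  ∃ n, q.1 = colX m n ∧ q.2 ≤ 0 ∧ α - β < q.2 ∧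
    ((p.1 = colX m n ∧ p.2 < 0) ∨ (p.1 = colX m (2 * n) + m ∧ p.2 = rowY m n))

/-- `d` is the word of a double ray which is directed towards the right before its first turn `α`
and after its last turn `β`, and `m` exceeds the distance between these. -/
structure IsInOutWord (d : ℤ → Bool) (m : ℕ) (α β : ℤ) : Prop where
  lt : α < β
  lt_add : β < α + m
  left : ∀ i < α, d i = true
  apply_first : d α = false
  apply_last : d (β - 1) = false
  right : ∀ i, β ≤ i → d i = true

variable (h : IsInOutWord d m α β)
include h

theorem IsInOutWord.pos : 0 < m := by
  have := h.lt
  have := h.lt_add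
  omega

/-- As the letters at `α` and `β - 1` are `false`, the core arcs there point into height `0` and out
of the row start; so every core arc has its head at height at most `0`. -/
theorem IsInOutWord.arc_cases {p q : ℤ × ℤ} (hpq : (grid d m α β).Adj p q) :
    IsColArc m p q ∨ IsRowArc m p q ∨ IsCoreArc m α β p q := by
  have hlt := h.lt
  obtain ⟨n, z, ⟨hz, rfl, rfl⟩ | ⟨hz, rfl, rfl⟩⟩ := hpq
  · have hzα : z ≠ α := by rintro rfl; simp [h.apply_first] at hz
    have hzβ : z ≠ β - 1 := by rintro rfl; simp [h.apply_last] at hz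
    rcases lt_or_ge z α with h₁ | h₁
    · left
      simp only [IsColArc, gridRay, if_pos (show z < β by omega),
        if_pos (show z + 1 < β by omega)]
      exact ⟨n, by simp only, by simp only, by ring, by omega⟩
    rcases lt_or_ge z β with h₂ | h₂
    · right; right
      simp only [IsCoreArc, gridRay, if_pos h₂, if_pos (show z + 1 < β by omega)]
      exact ⟨n, rfl, by omega, by omega, Or.inl ⟨rfl, by omega⟩⟩
    · right; left
      simp only [IsRowArc, gridRay, if_neg (show ¬ z < β by omega),
        if_neg (show ¬ z + 1 < β by omega)]
      exact ⟨n, by simp only, by simp only, by ring, by omega⟩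
  · have h₁ : α ≤ z := by
      by_contra! h₁
      simp [h.left z h₁] at hz
    have h₂ : z < β := by
      by_contra! h₂
      simp [h.right z h₂] at hz
    right; right
    rcases lt_or_ge (z + 1) β with h₃ | h₃
    · simp only [IsCoreArc, gridRay, if_pos h₂, if_pos h₃]
      exact ⟨n, rfl, by omega, by omega, Or.inl ⟨rfl, by omega⟩⟩
    · simp only [IsCoreArc, gridRay, if_pos h₂, if_neg (show ¬ z + 1 < β by omega)]
      exact ⟨n, rfl, by omega, by omega, Or.inr ⟨by omega, rfl⟩⟩

omit h in
theorem not_injective_of_bounded {p : ℕ → ℤ × ℤ} {a b c : ℤ} (k : ℕ)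
    (hp : ∀ j, k ≤ j → (p j).1 = c ∧ a < (p j).2 ∧ (p j).2 < b) : ¬ Function.Injective p := by
  intro hinj
  refine Set.infinite_of_injective_forall_mem (f := fun j => p (k + j))
    (fun i j hij => by simpa using hinj hij) (s := {c} ×ˢ Set.Ioo a b) (fun j => ?_)
    ((Set.finite_singleton c).prod (Set.finite_Ioo a b))
  have := hp (k + j) (by omega)
  exact ⟨this.1, this.2⟩

/-- An out-ray that reaches height `0` or less is trapped in a finite piece of one column. -/
theorem IsInOutWord.outRay_pos {p : ℕ → ℤ × ℤ} (hp : Function.Injective p)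
    (hadj : ∀ k, (grid d m α β).Adj (p k) (p (k + 1))) (k : ℕ) : 1 ≤ (p k).2 := by
  by_contra! hk
  have hstep : ∀ j, (p j).2 < 1 → ∃ n, (p j).1 = colX m n ∧ (p (j + 1)).1 = colX m n ∧
      α - β < (p (j + 1)).2 ∧ (p (j + 1)).2 < 1 := by
    intro j hj
    rcases h.arc_cases (hadj j) with ⟨c, h₁, h₂, h₃, h₄⟩ | ⟨r, h₁, h₂, h₃, h₄⟩ |
      ⟨n, h₁, h₂, h₃, h₄⟩
    · omega
    · have := le_rowY m r
      have := h.pos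
      omega
    · refine ⟨n, ?_, h₁, h₃, by omega⟩
      rcases h₄ with h₄ | h₄
      · exact h₄.1
      · have := le_rowY m n
        have := h.pos
        omega
  refine not_injective_of_bounded (a := α - β) (b := 1) (c := (p (k + 1)).1) (k + 1)
    (fun j hj => ?_) hp
  induction j, hj using Nat.le_induction with
  | base =>
    obtain ⟨n, h₁, h₂, h₃, h₄⟩ := hstep k hk
    exact ⟨rfl, h₃, h₄⟩
  | succ j hj ih =>
    obtain ⟨n, h₁, h₂, h₃, h₄⟩ := hstep j ih.2.2
    exact ⟨by omega, h₃, h₄⟩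

/-- Above height `0` arcs lead down or to the right, and descending must stop. -/
theorem IsInOutWord.outRay_next {p : ℕ → ℤ × ℤ} (hp : Function.Injective p)
    (hadj : ∀ k, (grid d m α β).Adj (p k) (p (k + 1))) (k : ℕ) :
    ∃ k', (p k').1 = (p k).1 + 1 ∧ (p k').2 ≤ (p k).2 := by
  induction hy : (p k).2.toNat using Nat.strong_induction_on generalizing k with
  | _ y ih =>
    have h₁ := h.outRay_pos hp hadj k
    have h₂ := h.outRay_pos hp hadj (k + 1)
    rcases h.arc_cases (hadj k) with ⟨c, h₃, h₄, h₅, -⟩ | ⟨r, h₃, h₄, h₅, -⟩ | ⟨n, -, h₃, -⟩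
    · obtain ⟨k', h₆, h₇⟩ := ih _ (by omega) (k + 1) rfl
      exact ⟨k', by omega, by omega⟩
    · exact ⟨k + 1, h₅, h₄.le⟩
    · omega

/-- Traced backwards from negative height, an in-ray stays in a finite piece of a column or reaches
a row start, which has no incoming arc. -/
theorem IsInOutWord.inRay_nonneg {q : ℕ → ℤ × ℤ} (hq : Function.Injective q)
    (hadj : ∀ k, (grid d m α β).Adj (q (k + 1)) (q k)) (k : ℕ) : 0 ≤ (q k).2 := by
  by_contra! hk
  have hpos := h.pos
  have hstep : ∀ j, (q j).2 < 0 → α - β < (q j).2 ∧ (q (j + 1)).1 = (q j).1 ∧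
      (q (j + 1)).2 < 0 := by
    intro j hj
    rcases h.arc_cases (hadj j) with ⟨c, h₁, h₂, h₃, h₄⟩ | ⟨r, h₁, h₂, h₃, h₄⟩ |
      ⟨n, h₁, h₂, h₃, h₄⟩
    · omega
    · have := le_rowY m r
      omega
    · refine ⟨h₃, ?_⟩
      rcases h₄ with h₄ | ⟨h₄, h₅⟩
      · exact ⟨by omega, h₄.2⟩
      · have := le_rowY m n
        rcases h.arc_cases (hadj (j + 1)) with ⟨c, h₆, h₇, -⟩ | ⟨r, h₆, h₇, h₈, h₉⟩ |
          ⟨n', -, h₆, -⟩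
        · have := colX_trichotomy m c (2 * n)
          omega
        · have := rowY_trichotomy m r n
          obtain rfl : r = n := by omega
          omega
        · omega
  have hall : ∀ j, k ≤ j → (q j).1 = (q k).1 ∧ (q j).2 < 0 := by
    intro j hj
    induction j, hj using Nat.le_induction with
    | base => exact ⟨rfl, hk⟩
    | succ j _ ih =>
      obtain ⟨-, h₁, h₂⟩ := hstep j ih.2
      exact ⟨by omega, h₂⟩
  exact not_injective_of_bounded k (fun j hj =>
    ⟨(hall j hj).1, (hstep j (hall j hj).2).1, (hall j hj).2⟩) hq

theorem IsInOutWord.inRay_arc {q : ℕ → ℤ × ℤ} (hq : Function.Injective q)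
    (hadj : ∀ k, (grid d m α β).Adj (q (k + 1)) (q k)) (k : ℕ) :
    IsColArc m (q (k + 1)) (q k) ∨ IsRowArc m (q (k + 1)) (q k) := by
  have hpos := h.pos
  rcases h.arc_cases (hadj k) with h₁ | h₁ | ⟨n, -, -, -, h₁ | ⟨h₁, h₂⟩⟩
  · exact Or.inl h₁
  · exact Or.inr h₁
  · have := h.inRay_nonneg hq hadj (k + 1)
    omega
  · have := le_rowY m n
    rcases h.arc_cases (hadj (k + 1)) with ⟨c, h₃, h₄, -⟩ | ⟨r, h₃, h₄, h₅, h₆⟩ | ⟨n', -, h₃, -⟩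
    · have := colX_trichotomy m c (2 * n)
      omega
    · have := rowY_trichotomy m r n
      obtain rfl : r = n := by omega
      omega
    · omega

/-- Every in-ray of the grid starts by coming down some column. -/
theorem IsInOutWord.inRay_column {q : ℕ → ℤ × ℤ} (hq : Function.Injective q)
    (hadj : ∀ k, (grid d m α β).Adj (q (k + 1)) (q k)) :
    ∃ (c K : ℕ) (y : ℤ), ∀ j : ℕ, q (K + j) = (colX m c, y + j) := by
  have hpos := h.pos
  have harc := h.inRay_arc hq hadj
  have hanti : ∀ k, (q (k + 1)).1 ≤ (q k).1 := fun k => by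
    rcases harc k with ⟨c, -, h₁, -⟩ | ⟨r, -, -, h₁, -⟩ <;> omega
  have hnonneg : ∀ k, 0 ≤ (q (k + 1)).1 := fun k => by
    rcases harc k with ⟨c, h₁, -⟩ | ⟨r, -, -, -, h₁⟩
    · have := colX_nonneg m c
      omega
    · have := colX_nonneg m (2 * r)
      omega
  -- Backwards, the abscissa never increases and is nonnegative; beyond its minimum only column arcs
  -- remain.
  obtain ⟨K, hK⟩ : ∃ K, ∀ k, (q (K + 1)).1.toNat ≤ (q (k + 1)).1.toNat :=
    ⟨Function.argmin (fun k => (q (k + 1)).1.toNat),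
      fun k => Function.argmin_le (fun k => (q (k + 1)).1.toNat) k⟩
  have hconst : ∀ j, (q (K + 1 + j)).1 = (q (K + 1)).1 := by
    intro j
    induction j with
    | zero => rfl
    | succ j ih =>
      have h₁ := hanti (K + 1 + j)
      have h₂ := hK (K + 1 + j)
      have h₃ := hnonneg (K + 1 + j)
      have h₄ := hnonneg K
      rw [← add_assoc]
      omega
  have hcol : ∀ j, IsColArc m (q (K + 1 + j + 1)) (q (K + 1 + j)) := fun j => by
    refine (harc (K + 1 + j)).resolve_right ?_
    rintro ⟨r, -, -, h₁, -⟩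
    have h₂ := hconst j
    have h₃ := hconst (j + 1)
    rw [← add_assoc] at h₃
    omega
  obtain ⟨c, hc, hc', -⟩ := hcol 0
  refine ⟨c, K + 1, (q (K + 1)).2, fun j => Prod.ext ?_ ?_⟩
  · rw [hconst]
    exact hc'.trans hc
  · induction j with
    | zero => simp
    | succ j ih =>
      obtain ⟨-, -, -, h₁, -⟩ := hcol j
      rw [← add_assoc]
      simp only at ih ⊢
      push_cast
      omega

/-- An out-ray of the grid meets each in-ray of the grid that ends at height `0` and comes down
a column to the right of the start of the out-ray. -/
theorem IsInOutWord.exists_outRay_eq_inRay {p q : ℕ → ℤ × ℤ} (hp : Function.Injective p)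
    (hpadj : ∀ k, (grid d m α β).Adj (p k) (p (k + 1))) (hq : Function.Injective q)
    (hqadj : ∀ k, (grid d m α β).Adj (q (k + 1)) (q k)) (hq0 : (q 0).2 = 0) {x y : ℤ} {K : ℕ}
    (hcol : ∀ j : ℕ, q (K + j) = (x, y + j)) (hx : (p 0).1 ≤ x) : ∃ i j, p i = q j := by
  by_contra! hne
  have hall : ∀ t : ℕ, ∃ k, (p k).1 = (p 0).1 + t := by
    intro t
    induction t with
    | zero => exact ⟨0, by simp⟩
    | succ t ih =>
      obtain ⟨k, hk⟩ := ih
      obtain ⟨k', hk', -⟩ := h.outRay_next hp hpadj k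
      exact ⟨k', by push_cast; omega⟩
  -- Down the in-ray, `p` keeps passing strictly below: a column step could only produce a common
  -- vertex, and a row step is matched by `outRay_next`.
  have habove : ∀ k, (∃ i, (p i).1 = (q (k + 1)).1 ∧ (p i).2 < (q (k + 1)).2) →
      ∃ i, (p i).1 = (q k).1 ∧ (p i).2 < (q k).2 := by
    rintro k ⟨i, h₁, h₂⟩
    rcases h.inRay_arc hq hqadj k with ⟨c, h₃, h₄, h₅, -⟩ | ⟨r, h₃, h₄, h₅, -⟩
    · refine ⟨i, by omega, lt_of_le_of_ne (by omega) fun heq => ?_⟩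
      exact hne i k (Prod.ext (by omega) heq)
    · obtain ⟨i', h₆, h₇⟩ := h.outRay_next hp hpadj i
      exact ⟨i', by omega, by omega⟩
  have htop : ∃ k, ∃ i, (p i).1 = (q k).1 ∧ (p i).2 < (q k).2 := by
    obtain ⟨i, hi⟩ := hall (x - (p 0).1).toNat
    refine ⟨K + ((p i).2 - y + 1).toNat, i, ?_⟩
    rw [hcol]
    simp only
    omega
  obtain ⟨k, hk⟩ := htop
  obtain ⟨i, h₁, h₂⟩ : ∃ i, (p i).1 = (q 0).1 ∧ (p i).2 < (q 0).2 := by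
    induction k with
    | zero => exact hk
    | succ k ih => exact ih (habove k hk)
  have := h.outRay_pos hp hpadj i
  omega

/-- The first turn of a copy in the grid lies at height `0`, since crossings of rows and columns are
too far away from other possible turns. -/
theorem IsInOutWord.snd_apply_first {f : ℤ → ℤ × ℤ} (hf : Function.Injective f)
    (hF : (grid d m α β).Follows d f) (h0 : 0 ≤ (f α).2) : (f α).2 = 0 := by
  have hpos := h.pos
  have hlt := h.lt
  have hlt' := h.lt_add
  by_contra hne
  -- `α + t` is the second turn of the word, so `f (α + t)` has two out-neighbours.
  obtain ⟨t, ht0, htm, htd, htf⟩ : ∃ t : ℕ, 0 < t ∧ t < m ∧ d (α + t) = true ∧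
      ∀ i : ℕ, i < t → d (α + i) = false := by
    classical
    have hex : ∃ t : ℕ, d (α + t) = true :=
      ⟨(β - α).toNat, h.right _ (by omega)⟩
    refine ⟨Nat.find hex, ?_, ?_, Nat.find_spec hex, fun i hi => ?_⟩
    · refine Nat.pos_of_ne_zero fun hz => ?_
      have := Nat.find_spec hex
      rw [hz] at this
      simp [h.apply_first] at this
    · have : Nat.find hex ≤ (β - α).toNat := Nat.find_min' hex (h.right _ (by omega))
      omega
    · simpa using Nat.find_min hex hi
  have hdown : ∀ i : ℕ, i < t → (grid d m α β).Adj (f (α + (i + 1 : ℕ))) (f (α + i)) :=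
    fun i hi => by
      rw [Nat.cast_succ, ← add_assoc]
      exact (hF _).2 (htf i hi)
  have hin : (grid d m α β).Adj (f (α - 1)) (f α) := by
    have := (hF (α - 1)).1 (h.left _ (by omega))
    rwa [sub_add_cancel] at this
  have hin' : (grid d m α β).Adj (f (α + 1)) (f α) := by simpa using hdown 0 ht0
  have hout : (grid d m α β).Adj (f (α + t)) (f (α + t + 1)) := (hF _).1 htd
  have hout' : (grid d m α β).Adj (f (α + t)) (f (α + t - 1)) := by
    have := hdown (t - 1) (by omega)
    rwa [show t - 1 + 1 = t by omega, show α + ((t - 1 : ℕ) : ℤ) = α + t - 1 by omega] at this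
  have hne₁ : f (α - 1) ≠ f (α + 1) := fun hh => by have := hf hh; omega
  have hne₂ : f (α + t + 1) ≠ f (α + t - 1) := fun hh => by have := hf hh; omega
  have hcross : (∃ c, (f α).1 = colX m c) ∧ ∃ r, (f α).2 = rowY m r ∧
      colX m (2 * r) + m < (f α).1 := by
    rcases h.arc_cases hin with ⟨c, h₁, h₂, h₃, -⟩ | ⟨r, h₁, h₂, h₃, h₄⟩ | ⟨n, -, h₁, -⟩ <;>
    rcases h.arc_cases hin' with ⟨c', h₁', h₂', h₃', -⟩ | ⟨r', h₁', h₂', h₃', h₄'⟩ |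
      ⟨n', -, h₁', -⟩
    · exact absurd (Prod.ext (by omega) (by omega)) hne₁
    · exact ⟨⟨c, by omega⟩, r', by omega, by omega⟩
    · omega
    · exact ⟨⟨c', by omega⟩, r, by omega, by omega⟩
    · exact absurd (Prod.ext (by omega) (by omega)) hne₁
    · omega
    · omega
    · omega
    · omega
  obtain ⟨⟨c, hc⟩, r, hr, hcr⟩ := hcross
  have hmr := le_rowY m r
  have hcr' := colX_trichotomy m c (2 * r)
  -- Fewer than `m` steps back from a crossing, whether up the column or left along the row, there
  -- is no other crossing and no row start, hence no vertex with two out-neighbours.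
  have hwalk : (∀ i : ℕ, i < t → f (α + (i + 1 : ℕ)) = (colX m c, rowY m r + (i + 1 : ℕ))) ∨
      ∀ i : ℕ, i < t → f (α + (i + 1 : ℕ)) = (colX m c - (i + 1 : ℕ), rowY m r) := by
    have hin'' : IsColArc m (f (α + 1)) (f α) ∨ IsRowArc m (f (α + 1)) (f α) := by
      rcases h.arc_cases hin' with h₁ | h₁ | ⟨n, -, h₁, -⟩
      · exact Or.inl h₁
      · exact Or.inr h₁
      · omega
    refine hin''.imp ?_ ?_
    · rintro ⟨c', h₁, h₂, h₃, -⟩ i hi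
      induction i with
      | zero =>
        rw [zero_add, Nat.cast_one]
        exact Prod.ext (by simp only; omega) (by simp only; omega)
      | succ i ih =>
        have hi' := ih (by omega)
        have hd := hdown (i + 1) hi
        rw [hi'] at hd
        rcases h.arc_cases hd with ⟨c', h₁, h₂, h₃, -⟩ | ⟨r', h₁, h₂, h₃, h₄⟩ | ⟨n, -, h₁, -⟩
        · exact Prod.ext (by simp only at *; omega) (by simp only at *; push_cast at *; omega)
        · have := rowY_trichotomy m r r'
          simp only at *
          push_cast at *
          omega
        · simp only at *
          push_cast at *
          omega
    · rintro ⟨r', h₁, h₂, h₃, -⟩ i hi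
      induction i with
      | zero =>
        rw [zero_add, Nat.cast_one]
        exact Prod.ext (by simp only; omega) (by simp only; omega)
      | succ i ih =>
        have hi' := ih (by omega)
        have hd := hdown (i + 1) hi
        rw [hi'] at hd
        rcases h.arc_cases hd with ⟨c', h₁, h₂, h₃, -⟩ | ⟨r', h₁, h₂, h₃, h₄⟩ | ⟨n, -, h₁, -⟩
        · have := colX_trichotomy m c c'
          simp only at *
          push_cast at *
          omega
        · exact Prod.ext (by simp only at *; push_cast at *; omega) (by simp only at *; omega)
        · simp only at *
          omega
  rcases hwalk with hwalk | hwalk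
  · have ht := hwalk (t - 1) (by omega)
    rw [show t - 1 + 1 = t by omega] at ht
    have huniq : ∀ q, (grid d m α β).Adj (f (α + t)) q → q = (colX m c, rowY m r + t - 1) := by
      intro q hq
      rw [ht] at hq
      rcases h.arc_cases hq with ⟨c', h₁, h₂, h₃, -⟩ | ⟨r', h₁, -⟩ | ⟨n, -, -, -, h₁ | h₁⟩
      · exact Prod.ext h₂ h₃
      · have := rowY_trichotomy m r r'
        simp only at *
        omega
      · simp only at *
        omega
      · have := rowY_trichotomy m r n
        simp only at *
        omega
    exact hne₂ ((huniq _ hout).trans (huniq _ hout').symm)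
  · have ht := hwalk (t - 1) (by omega)
    rw [show t - 1 + 1 = t by omega] at ht
    have huniq : ∀ q, (grid d m α β).Adj (f (α + t)) q → q = (colX m c - t + 1, rowY m r) := by
      intro q hq
      rw [ht] at hq
      rcases h.arc_cases hq with ⟨c', h₁, -⟩ | ⟨r', h₁, h₂, h₃, -⟩ | ⟨n, -, -, -, h₁ | h₁⟩
      · have := colX_trichotomy m c c'
        simp only at *
        omega
      · exact Prod.ext h₃ h₂
      · simp only at *
        omega
      · have := rowY_trichotomy m r n
        obtain rfl : r = n := by simp only at *; omega
        simp only at *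
        omega
    exact hne₂ ((huniq _ hout).trans (huniq _ hout').symm)

theorem IsInOutWord.exists_disjoint (k : ℕ) :
    ∃ f : Fin k → ℤ → ℤ × ℤ, (∀ i, Function.Injective (f i)) ∧
      (∀ i, (grid d m α β).Follows d (f i)) ∧ ∀ i j x y, f i x = f j y → i = j := by
  refine ⟨fun i => gridRay m α β (k + i), fun i x y hxy => ?_, fun i z => ⟨fun hz => ?_,
    fun hz => ?_⟩, fun i j x y hxy => ?_⟩
  · exact (gridRay_eq h.pos (by omega) (by omega) hxy).2
  · exact ⟨k + i, z, Or.inl ⟨hz, rfl, rfl⟩⟩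
  · exact ⟨k + i, z, Or.inr ⟨hz, rfl, rfl⟩⟩
  · have := (gridRay_eq h.pos (by omega) (by omega) hxy).1
    exact Fin.ext (by omega)

theorem IsInOutWord.not_exists_infinite_disjoint :
    ¬ ∃ f : ℕ → ℤ → ℤ × ℤ, (∀ i, Function.Injective (f i)) ∧
      (∀ i, (grid d m α β).Follows d (f i)) ∧ ∀ i j x y, f i x = f j y → i = j := by
  rintro ⟨f, hf, hF, hdis⟩
  have hp : Function.Injective fun k : ℕ => f 0 (β + k) := fun k k' hk => by
    have := hf 0 hk
    omega
  have hpadj : ∀ k : ℕ, (grid d m α β).Adj (f 0 (β + k)) (f 0 (β + (k + 1 : ℕ))) := fun k => by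
    rw [Nat.cast_succ, ← add_assoc]
    exact (hF 0 _).1 (h.right _ (by omega))
  have hq : ∀ i, Function.Injective fun k : ℕ => f i (α - k) := fun i k k' hk => by
    have := hf i hk
    omega
  have hqadj : ∀ i (k : ℕ), (grid d m α β).Adj (f i (α - (k + 1 : ℕ))) (f i (α - k)) :=
    fun i k => by
      have := (hF i (α - (k + 1 : ℕ))).1 (h.left _ (by omega))
      rwa [show α - ((k + 1 : ℕ) : ℤ) + 1 = α - k by push_cast; ring] at this
  have hq0 : ∀ i, (f i (α - (0 : ℕ))).2 = 0 := fun i => by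
    have h₁ := h.inRay_nonneg (hq i) (hqadj i) 0
    simp only [Nat.cast_zero, sub_zero] at h₁ ⊢
    exact h.snd_apply_first (hf i) (hF i) h₁
  choose c K y hcol using fun i => h.inRay_column (hq i) (hqadj i)
  have hc : Function.Injective c := fun i j hij => by
    -- In-rays in the same column share the height `max (y i) (y j)`; one of the two truncated
    -- differences is `0`.
    have h₁ := hcol i (y j - y i).toNat
    rw [hij, show y i + ((y j - y i).toNat : ℤ) = y j + ((y i - y j).toNat : ℕ) by omega,
      ← hcol j] at h₁
    exact hdis i j _ _ h₁
  obtain ⟨i, hi, hi0⟩ := ((hc.nat_tendsto_atTop.eventually_ge_atTop (f 0 β).1.toNat).and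
    (Filter.eventually_ge_atTop 1)).exists
  have hle : (f 0 (β + (0 : ℕ))).1 ≤ colX m (c i) := by
    have := h.pos
    have : (c i : ℤ) ≤ colX m (c i) := by
      unfold colX
      nlinarith
    simp only [Nat.cast_zero, add_zero]
    omega
  obtain ⟨s, t, hst⟩ := h.exists_outRay_eq_inRay hp hpadj (hq i) (hqadj i) (hq0 i) (hcol i) hle
  have := hdis _ _ _ _ hst
  omega

omit h in
theorem exists_isInOutWord {N : ℕ} (hr : ∀ i : ℤ, N ≤ i → d i = true)
    (hl : ∀ i : ℤ, i ≤ -N → d i = true) (hex : ∃ i, d i = false) :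
    ∃ m α β, IsInOutWord d m α β := by
  have hbd : ∀ i, d i = false → -N ≤ i ∧ i ≤ N := fun i hi => by
    constructor
    · by_contra! hlt
      simp [hl i hlt.le] at hi
    · by_contra! hlt
      simp [hr i hlt.le] at hi
  obtain ⟨α, hα, hα'⟩ := Int.exists_least_of_bdd (P := fun i => d i = false)
    ⟨-N, fun i hi => (hbd i hi).1⟩ hex
  obtain ⟨β, hβ, hβ'⟩ := Int.exists_greatest_of_bdd (P := fun i => d i = false)
    ⟨N, fun i hi => (hbd i hi).2⟩ hex
  have := hα' β hβ
  refine ⟨(β + 1 - α).toNat + 1, α, β + 1, by omega, by push_cast; omega, fun i hi => ?_, hα,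
    by simpa using hβ, fun i hi => ?_⟩
  · rw [← Bool.not_eq_false]
    exact fun hf => not_lt_of_ge (hα' i hf) hi
  · rw [← Bool.not_eq_false]
    exact fun hf => by have := hβ' i hf; omega

end Grid

/-- An oriented double ray which has a turn and consists, up to finitely many arcs, of an in-ray and
an out-ray, is not ubiquitous. -/
theorem IsWord.not_isUbiquitous_of_eq {V : Type u} {R : Digraph V} {e : ℤ ≃ V} {d : ℤ → Bool}
    (h : R.IsWord e d) {N : ℕ} {b : Bool} (hr : ∀ i : ℤ, N ≤ i → d i = b)
    (hl : ∀ i : ℤ, i ≤ -N → d i = b) (hturn : (turnPositions d).Nonempty) :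
    ¬ IsUbiquitous.{u, v} R := by
  have key : ∀ (e' : ℤ ≃ V) (d' : ℤ → Bool) (M : ℕ), R.IsWord e' d' →
      (∀ i : ℤ, M ≤ i → d' i = true) → (∀ i : ℤ, i ≤ -M → d' i = true) →
      (∃ i, d' i = false) → ¬ IsUbiquitous.{u, v} R := by
    intro e' d' M h' hr' hl' hex
    obtain ⟨m, α, β, hd⟩ := exists_isInOutWord hr' hl' hex
    exact h'.not_isUbiquitous (grid d' m α β) hd.exists_disjoint hd.not_exists_infinite_disjoint
  obtain ⟨i, hi⟩ := hturn
  have hex : ∃ j, d j = !b := by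
    by_contra! hne
    simp only [ne_eq, Bool.not_eq_not] at hne
    exact hi ((hne _).trans (hne _).symm)
  obtain ⟨j, hj⟩ := hex
  cases b
  -- `N + 1` absorbs the index shift in `flipWord`.
  · exact key _ _ (N + 1) h.flip
      (fun i hi => by simp [flipWord, hl (-i - 1) (by push_cast at hi; omega)])
      (fun i hi => by simp [flipWord, hr (-i - 1) (by push_cast at hi; omega)])
      ⟨-j - 1, by simp [flipWord, hj]⟩
  · exact key e d N h hr hl ⟨j, hj⟩

/-! ### Gluing sources to sinks: infinitely many turns -/

section Gluing

/-- The word read along the leg of a double ray which goes from position `0` in direction `δ`. -/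
def reading (d : ℤ → Bool) (δ s : ℤ) : Bool := if δ = 1 then d s else !d (-s - 1)

/-- A word has turns arbitrarily far to the right. -/
def HasFarTurns (v : ℤ → Bool) : Prop := ∀ K : ℤ, ∃ s ≥ K, v (s - 1) ≠ v s

variable {d : ℤ → Bool}

theorem reading_neg {δ : ℤ} (hδ : δ = 1 ∨ δ = -1) (s : ℤ) :
    reading d (-δ) s = !reading d δ (-s - 1) := by
  rcases hδ with rfl | rfl
  · simp [reading]
  · simp [reading]

/-- Turns of the two kinds alternate. -/
theorem HasFarTurns.exists_ge {v : ℤ → Bool} (h : HasFarTurns v) (K : ℤ) (b : Bool) :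
    ∃ s ≥ K, v (s - 1) = b ∧ v s = !b := by
  by_contra! hne
  have hstep : ∀ s ≥ K, v (s - 1) = b → v s = b := fun s hs hb => by
    simpa using hne s hs hb
  obtain ⟨s, hs, hs'⟩ := h K
  have hsb : v s = b := by
    by_contra hb
    exact hs' (by
      by_cases hb' : v (s - 1) = b
      · exact absurd (hstep s hs hb') hb
      · rw [Bool.eq_not_of_ne hb, Bool.eq_not_of_ne hb'])
  have hall : ∀ n : ℕ, v (s + n) = b := fun n => by
    induction n with
    | zero => simpa using hsb
    | succ n ih =>
      refine hstep _ (by push_cast; omega) ?_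
      rwa [show s + ((n + 1 : ℕ) : ℤ) - 1 = s + n by push_cast; ring]
  obtain ⟨t, ht, ht'⟩ := h (s + 1)
  have h₁ := hall (t - 1 - s).toNat
  have h₂ := hall (t - s).toNat
  rw [show s + ((t - 1 - s).toNat : ℤ) = t - 1 by omega] at h₁
  rw [show s + ((t - s).toNat : ℤ) = t by omega] at h₂
  exact ht' (h₁.trans h₂.symm)

/-- There are finitely many shifts `t`; `N` lies beyond one disagreement for each shift that has
any. -/
theorem exists_window (v w : ℤ → Bool) (K : ℤ) (B : ℕ) :
    ∃ N : ℤ, ∀ t : ℤ, |t| ≤ B → (∀ s, K ≤ s → s < N → w (t + s) = v s) →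
      ∀ s, K ≤ s → w (t + s) = v s := by
  have hN : ∀ t : ℤ, ∃ N : ℤ, (∀ s, K ≤ s → s < N → w (t + s) = v s) →
      ∀ s, K ≤ s → w (t + s) = v s := fun t => by
    by_cases h : ∀ s, K ≤ s → w (t + s) = v s
    · exact ⟨0, fun _ => h⟩
    · push Not at h
      obtain ⟨s, hs, hne⟩ := h
      exact ⟨s + 1, fun h' => absurd (h' s hs (by omega)) hne⟩
  choose N hN using hN
  obtain ⟨M, hM⟩ := ((Set.finite_Icc (-B : ℤ) B).image N).bddAbove
  exact ⟨M, fun t ht h => hN t fun s hs hsN => h s hs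
    (hsN.trans_le (hM ⟨t, abs_le.1 ht, rfl⟩))⟩

/-- A turn `p`, of kind `b`, at a distance `s₀ > K` from the origin, such that any part of `d`, up to
a shift by at most `B`, which agrees with the word read on the way to `p` from distance `K` on, also
agrees with the arc following `p`. -/
def GoodPlace (d : ℤ → Bool) (K B : ℕ) (b : Bool) (p : ℤ) : Prop :=
  ∃ δ s₀ : ℤ, (δ = 1 ∨ δ = -1) ∧ p = δ * s₀ ∧ K < s₀ ∧ reading d δ (s₀ - 1) = b ∧
    reading d δ s₀ = !b ∧ ∀ t : ℤ, |t| ≤ B →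
      (∀ s : ℤ, K ≤ s → s < s₀ → d (t + s) = reading d δ s) → d (t + s₀) = reading d δ s₀

theorem exists_goodPlace {δ : ℤ} (hδ : δ = 1 ∨ δ = -1) (h : HasFarTurns (reading d δ))
    (K B : ℕ) (b : Bool) : ∃ s : ℤ, K < s ∧ GoodPlace d K B b (δ * s) := by
  obtain ⟨N, hN⟩ := exists_window (reading d δ) d K B
  obtain ⟨s, hs, h₁, h₂⟩ := h.exists_ge (max (K + 1) N) b
  have hK : (K + 1 : ℤ) ≤ s := (le_max_left _ _).trans hs
  have hsN : N ≤ s := (le_max_right _ _).trans hs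
  exact ⟨s, by omega, δ, s, hδ, rfl, by omega, h₁, h₂, fun t ht hag =>
    hN t ht (fun s' h₃ h₄ => hag s' h₃ (by omega)) s (by omega)⟩

/-- The kind of a turn does not depend on the side of arrival: a source is reached against an arc, a
sink along one. -/
theorem GoodPlace.reading_arrive {K B : ℕ} {b : Bool} {p δ : ℤ} (hδ : δ = 1 ∨ δ = -1)
    (h : GoodPlace d K B b (p + δ)) : reading d δ (δ * p) = b := by
  obtain ⟨δ₀, s₀, hδ₀, hp, -, h₁, h₂, -⟩ := h
  have hδδ : δ = δ₀ ∨ δ = -δ₀ := by omega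
  have hsq : δ₀ * δ₀ = 1 := by rcases hδ₀ with rfl | rfl <;> norm_num
  obtain rfl : p = δ₀ * s₀ - δ := by omega
  rcases hδδ with rfl | rfl
  · rw [mul_sub, ← mul_assoc, hsq, one_mul, h₁]
  · rw [show -δ₀ * (δ₀ * s₀ - -δ₀) = -(δ₀ * δ₀) * (s₀ + 1) by ring, hsq, reading_neg hδ₀,
      show -(-1 * (s₀ + 1)) - 1 = s₀ by ring, h₂, Bool.not_not]

theorem GoodPlace.reading_depart {K B : ℕ} {b : Bool} {p δ : ℤ} (hδ : δ = 1 ∨ δ = -1)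
    (h : GoodPlace d K B b p) : reading d δ (δ * p) = !b := by
  obtain ⟨δ₀, s₀, hδ₀, rfl, -, h₁, h₂, -⟩ := h
  have hδδ : δ = δ₀ ∨ δ = -δ₀ := by omega
  have hsq : δ₀ * δ₀ = 1 := by rcases hδ₀ with rfl | rfl <;> norm_num
  rcases hδδ with rfl | rfl
  · rw [← mul_assoc, hsq, one_mul, h₂]
  · rw [← mul_assoc, neg_mul, hsq, reading_neg hδ₀, show -(-1 * s₀) - 1 = s₀ - 1 by ring, h₁]

theorem GoodPlace.lt_abs {K B : ℕ} {b : Bool} {p : ℤ} (h : GoodPlace d K B b p) : K < |p| := by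
  obtain ⟨δ, s, hδ, rfl, h, -⟩ := h
  rcases hδ with rfl | rfl
  · rw [one_mul]
    exact h.trans_le (le_abs_self s)
  · rw [neg_one_mul, abs_neg]
    exact h.trans_le (le_abs_self s)

/-- Identification of the points `l m` and `r m`, for each `m`. -/
noncomputable def glue {X : Type*} (l r : ℕ → X) (x : X) : X :=
  open Classical in if h : ∃ m, x = r m then l h.choose else x

/-- The data of a gluing of double rays with word `d`, numbered by `ℕ`: a source at `l m` is glued
to a sink at `r m`, and the places grow fast. -/
structure IsGluing (d : ℤ → Bool) (l r : ℕ → ℕ × ℤ) (K : ℕ → ℕ) : Prop where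
  lt : ∀ m, 2 * (l m).1 < (r m).1
  bound : ∀ j m, j < m → |(l j).2| < K m ∧ |(r j).2| < K m
  left : ∀ m, GoodPlace d (K m) (m + 2 * m * K m) false (l m).2
  right : ∀ m, GoodPlace d (K m) (m + 2 * m * K m) true (r m).2

variable {l r : ℕ → ℕ × ℤ} {K : ℕ → ℕ}

theorem IsGluing.left_injective (h : IsGluing d l r K) : Function.Injective l := by
  have key : ∀ i j, i < j → l i ≠ l j := fun i j hij heq => by
    have h₁ := (h.bound i j hij).1
    have h₂ := (h.left j).lt_abs
    rw [heq] at h₁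
    omega
  intro i j hij
  rcases lt_trichotomy i j with h' | h' | h'
  exacts [absurd hij (key _ _ h'), h', absurd hij.symm (key _ _ h')]

theorem IsGluing.right_injective (h : IsGluing d l r K) : Function.Injective r := by
  have key : ∀ i j, i < j → r i ≠ r j := fun i j hij heq => by
    have h₁ := (h.bound i j hij).2
    have h₂ := (h.right j).lt_abs
    rw [heq] at h₁
    omega
  intro i j hij
  rcases lt_trichotomy i j with h' | h' | h'
  exacts [absurd hij (key _ _ h'), h', absurd hij.symm (key _ _ h')]

theorem IsGluing.left_ne_right (h : IsGluing d l r K) (i j : ℕ) : l i ≠ r j := by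
  intro heq
  rcases lt_trichotomy i j with h' | rfl | h'
  · have h₁ := (h.bound i j h').1
    have h₂ := (h.right j).lt_abs
    rw [heq] at h₁
    omega
  · have := h.lt i
    rw [heq] at this
    omega
  · have h₁ := (h.bound j i h').2
    have h₂ := (h.left i).lt_abs
    rw [heq] at h₂
    omega

theorem IsGluing.le_bound (h : IsGluing d l r K) (m : ℕ) : m ≤ K m := by
  induction m with
  | zero => omega
  | succ m ih =>
    have h₁ := (h.bound m (m + 1) (by omega)).1
    have h₂ := (h.left m).lt_abs
    omega

theorem IsGluing.glue_right (h : IsGluing d l r K) (m : ℕ) : glue l r (r m) = l m := by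
  have hex : ∃ m', r m = r m' := ⟨m, rfl⟩
  rw [glue, dif_pos hex, ← h.right_injective hex.choose_spec]

theorem IsGluing.glue_of_ne {x : ℕ × ℤ} (hx : ∀ m, x ≠ r m) : glue l r x = x :=
  dif_neg fun ⟨m, hm⟩ => hx m hm

theorem IsGluing.glue_left (h : IsGluing d l r K) (m : ℕ) : glue l r (l m) = l m :=
  glue_of_ne fun _ => h.left_ne_right _ _

theorem IsGluing.eq_of_glue_eq (h : IsGluing d l r K) {x y : ℕ × ℤ}
    (hxy : glue l r x = glue l r y) :
    x = y ∨ ∃ m, (x = l m ∧ y = r m) ∨ (x = r m ∧ y = l m) := by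
  by_cases hx : ∃ m, x = r m <;> by_cases hy : ∃ m, y = r m
  · obtain ⟨m, rfl⟩ := hx
    obtain ⟨m', rfl⟩ := hy
    rw [h.glue_right, h.glue_right] at hxy
    rw [h.left_injective hxy]
    exact Or.inl rfl
  · obtain ⟨m, rfl⟩ := hx
    rw [h.glue_right, glue_of_ne (not_exists.1 hy)] at hxy
    exact Or.inr ⟨m, Or.inr ⟨rfl, hxy.symm⟩⟩
  · obtain ⟨m, rfl⟩ := hy
    rw [h.glue_right, glue_of_ne (not_exists.1 hx)] at hxy
    exact Or.inr ⟨m, Or.inl ⟨hxy, rfl⟩⟩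
  · rw [glue_of_ne (not_exists.1 hx), glue_of_ne (not_exists.1 hy)] at hxy
    exact Or.inl hxy

/-- The union of disjoint double rays with word `d`, numbered by `ℕ`, with `l m` and `r m` glued. -/
def glued (d : ℤ → Bool) (l r : ℕ → ℕ × ℤ) : Digraph (ℕ × ℤ) where
  Adj x y := ∃ a p, (d p = true ∧ x = glue l r (a, p) ∧ y = glue l r (a, p + 1)) ∨
    (d p = false ∧ x = glue l r (a, p + 1) ∧ y = glue l r (a, p))

/-- The ray `f` in `glued d l r` has the word `d` to the right of the origin, and its arc number `n`
comes from the double ray `a n`, where it leads from `p n` to `p n + δ n`. -/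
structure IsTrace (d : ℤ → Bool) (l r : ℕ → ℕ × ℤ) (f : ℕ → ℕ × ℤ) (a : ℕ → ℕ) (p δ : ℕ → ℤ) :
    Prop where
  inj : Function.Injective f
  sign : ∀ n, δ n = 1 ∨ δ n = -1
  start : ∀ n, f n = glue l r (a n, p n)
  next : ∀ n, f (n + 1) = glue l r (a n, p n + δ n)
  read : ∀ n : ℕ, d n = reading d (δ n) (δ n * p n)

theorem exists_isTrace {f : ℤ → ℕ × ℤ} (hf : Function.Injective f)
    (hF : (glued d l r).Follows d f) : ∃ a p δ, IsTrace d l r (fun n => f n) a p δ := by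
  have hstep : ∀ n : ℕ, ∃ (a : ℕ) (p δ : ℤ), (δ = 1 ∨ δ = -1) ∧ f n = glue l r (a, p) ∧
      f (n + 1) = glue l r (a, p + δ) ∧ d n = reading d δ (δ * p) := by
    intro n
    cases hn : d n
    · obtain ⟨a, p, ⟨h₁, h₂, h₃⟩ | ⟨h₁, h₂, h₃⟩⟩ := (hF n).2 hn
      · exact ⟨a, p + 1, -1, Or.inr rfl, h₃, by rw [h₂]; congr 2; ring, by
          simp [reading, h₁]⟩
      · exact ⟨a, p, 1, Or.inl rfl, h₃, h₂, by simp [reading, h₁]⟩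
    · obtain ⟨a, p, ⟨h₁, h₂, h₃⟩ | ⟨h₁, h₂, h₃⟩⟩ := (hF n).1 hn
      · exact ⟨a, p, 1, Or.inl rfl, h₂, h₃, by simp [reading, h₁]⟩
      · exact ⟨a, p + 1, -1, Or.inr rfl, h₂, by rw [h₃]; congr 2; ring, by
          simp [reading, h₁]⟩
  choose a p δ h₁ h₂ h₃ h₄ using hstep
  exact ⟨a, p, δ, fun x y hxy => by simpa using hf hxy, h₁, h₂,
    fun n => by simpa using h₃ n, h₄⟩

variable {f : ℕ → ℕ × ℤ} {a : ℕ → ℕ} {p δ : ℕ → ℤ}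

/-- After its arc number `n`, the trace moves on to another double ray at the gluing number `m`. -/
def SwitchesAt (l r : ℕ → ℕ × ℤ) (a : ℕ → ℕ) (p δ : ℕ → ℤ) (n m : ℕ) : Prop :=
  ((a n, p n + δ n) = l m ∧ (a (n + 1), p (n + 1)) = r m) ∨
    ((a n, p n + δ n) = r m ∧ (a (n + 1), p (n + 1)) = l m)

theorem IsTrace.continues_or_switches (h : IsGluing d l r K) (ht : IsTrace d l r f a p δ) (n : ℕ) :
    (a (n + 1) = a n ∧ p (n + 1) = p n + δ n ∧ δ (n + 1) = δ n) ∨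
      ∃ m, SwitchesAt l r a p δ n m := by
  have heq := (ht.next n).symm.trans (ht.start (n + 1))
  rcases h.eq_of_glue_eq heq with h' | ⟨m, hm⟩
  · left
    simp only [Prod.mk.injEq] at h'
    refine ⟨h'.1.symm, h'.2.symm, ?_⟩
    by_contra hne
    have h₁ := ht.next (n + 1)
    have hδ : δ (n + 1) = -δ n := by
      have := ht.sign n
      have := ht.sign (n + 1)
      omega
    rw [← h'.1, ← h'.2, hδ, add_neg_cancel_right, ← ht.start n] at h₁
    have := ht.inj h₁
    omega
  · exact Or.inr ⟨m, hm⟩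

theorem SwitchesAt.apply_eq (h : IsGluing d l r K) (ht : IsTrace d l r f a p δ) {n m : ℕ}
    (hs : SwitchesAt l r a p δ n m) : f (n + 1) = l m := by
  rw [ht.next]
  rcases hs with ⟨h₁, -⟩ | ⟨h₁, -⟩
  · rw [h₁, h.glue_left]
  · rw [h₁, h.glue_right]

/-- The letter read on arrival at a source is the one read on departure from a sink, and vice versa.
So the word has no turn at a switch, though the double ray being left has one. -/
theorem SwitchesAt.exists_goodPlace (h : IsGluing d l r K) (ht : IsTrace d l r f a p δ) {n m : ℕ}
    (hs : SwitchesAt l r a p δ n m) :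
    ∃ b, GoodPlace d (K m) (m + 2 * m * K m) b (p n + δ n) ∧ d n = b ∧ d (n + 1 : ℕ) = b := by
  have hl := h.left m
  have hr := h.right m
  rcases hs with ⟨h₁, h₂⟩ | ⟨h₁, h₂⟩
  · rw [← h₁] at hl
    rw [← h₂] at hr
    exact ⟨false, hl, (ht.read n).trans (hl.reading_arrive (ht.sign n)),
      (ht.read (n + 1)).trans (hr.reading_depart (ht.sign (n + 1)))⟩
  · rw [← h₁] at hr
    rw [← h₂] at hl
    exact ⟨true, hr, (ht.read n).trans (hr.reading_arrive (ht.sign n)),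
      (ht.read (n + 1)).trans (hl.reading_depart (ht.sign (n + 1)))⟩

theorem SwitchesAt.abs_lt (h : IsGluing d l r K) {n j m : ℕ} (hs : SwitchesAt l r a p δ n j)
    (hj : j < m) : |p n + δ n| < K m ∧ |p (n + 1)| < K m := by
  obtain ⟨hl, hr⟩ := h.bound j m hj
  rcases hs with ⟨h₁, h₂⟩ | ⟨h₁, h₂⟩
  · rw [← h₁] at hl
    rw [← h₂] at hr
    exact ⟨hl, hr⟩
  · rw [← h₁] at hr
    rw [← h₂] at hl
    exact ⟨hr, hl⟩

/-- As long as a trace switches only at the first `m` gluings, the difference between the position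
in the trace and the position on the current double ray is bounded. -/
theorem IsTrace.abs_shift_le (h : IsGluing d l r K) (ht : IsTrace d l r f a p δ) {m n : ℕ}
    (hn : ∀ k < n, ∀ j, SwitchesAt l r a p δ k j → j < m) (hp : |p 0| ≤ m) :
    |n - δ n * p n| ≤ (m + 2 * m * K m : ℕ) := by
  classical
  -- `G k` lists the early gluings already passed. Each is passed at most once by injectivity, and a
  -- switch there changes the shift by at most `2 * K m`.
  let G : ℕ → Finset ℕ := fun k => {j ∈ Finset.range m | ∃ i ≤ k, f i = l j}
  have hmono : ∀ k, G k ⊆ G (k + 1) := fun k j hj => by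
    simp only [G, Finset.mem_filter] at hj ⊢
    obtain ⟨h₁, i, hi, h₂⟩ := hj
    exact ⟨h₁, i, by omega, h₂⟩
  have habs : ∀ k x, |δ k * x| = |x| := fun k x => by
    rcases ht.sign k with h₁ | h₁ <;> simp [h₁]
  have key : ∀ k ≤ n, |k - δ k * p k| ≤ m + 2 * K m * (G k).card := by
    intro k hk
    induction k with
    | zero =>
      rw [Nat.cast_zero, zero_sub, abs_neg, habs]
      exact hp.trans (by linarith [show (0 : ℤ) ≤ 2 * K m * (G 0).card by positivity])
    | succ k ih =>
      have ih := ih (by omega)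
      have hsq : δ k * δ k = 1 := by rcases ht.sign k with h₁ | h₁ <;> simp [h₁]
      have hshift : (k : ℤ) - δ k * p k = k + 1 - δ k * (p k + δ k) := by
        rw [mul_add, hsq]; ring
      rw [hshift] at ih
      rcases ht.continues_or_switches h k with ⟨-, h₂, h₃⟩ | ⟨j, hj⟩
      · rw [h₂, h₃]
        push_cast
        refine ih.trans ?_
        gcongr
        exact hmono k
      · have hjm := hn k (by omega) j hj
        obtain ⟨h₁, h₂⟩ := hj.abs_lt h hjm
        have hf := hj.apply_eq h ht
        have hcard : (G k).card + 1 ≤ (G (k + 1)).card := by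
          have hjk : j ∉ G k := fun hmem => by
            obtain ⟨-, i, hi, h₃⟩ := Finset.mem_filter.1 hmem
            have := ht.inj (h₃.trans hf.symm)
            omega
          rw [← Finset.card_insert_of_notMem hjk]
          refine Finset.card_le_card (Finset.insert_subset ?_ (hmono k))
          exact Finset.mem_filter.2 ⟨Finset.mem_range.2 hjm, k + 1, le_rfl, hf⟩
        have hcard' : (2 * K m : ℤ) * ((G k).card + 1) ≤ 2 * K m * (G (k + 1)).card := by
          gcongr
          exact_mod_cast hcard
        rw [← habs k] at h₁
        rw [← habs (k + 1)] at h₂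
        push_cast
        rw [abs_le] at ih ⊢
        rw [abs_lt] at h₁ h₂
        constructor <;> linarith
  refine (key n le_rfl).trans ?_
  have : (G n).card ≤ m := (Finset.card_filter_le _ _).trans (by simp)
  push_cast
  nlinarith [show (0 : ℤ) ≤ K m by positivity, show ((G n).card : ℤ) ≤ m by exact_mod_cast this,
    mul_le_mul_of_nonneg_left (show ((G n).card : ℤ) ≤ m by exact_mod_cast this)
      (show (0 : ℤ) ≤ K m by positivity)]

/-- A trace can be followed backwards along a double ray while it stays far from the origin. -/
theorem IsTrace.backwards (h : IsGluing d l r K) (ht : IsTrace d l r f a p δ) {m n : ℕ}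
    (hn : ∀ k < n, ∀ j, SwitchesAt l r a p δ k j → j < m) (hp : |p 0| < K m) (i : ℕ)
    (hi : ∀ i' < i, (K m : ℤ) ≤ |p n - i' * δ n|) :
    i ≤ n ∧ p (n - i) = p n - i * δ n ∧ δ (n - i) = δ n := by
  induction i with
  | zero => simp
  | succ i ih =>
    obtain ⟨h₁, h₃, h₄⟩ := ih fun i' hi' => hi i' (by omega)
    have hlarge := hi i (by omega)
    rw [← h₃] at hlarge
    have hni : n - i ≠ 0 := fun h0 => by
      rw [h0] at hlarge
      omega
    obtain ⟨k, hk⟩ := Nat.exists_eq_succ_of_ne_zero hni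
    rw [Nat.succ_eq_add_one] at hk
    rw [hk] at h₃ h₄ hlarge
    rcases ht.continues_or_switches h k with ⟨-, h₆, h₇⟩ | ⟨j, hj⟩
    · rw [show n - (i + 1) = k by omega]
      refine ⟨by omega, ?_, by omega⟩
      push_cast
      rw [← h₄, h₇] at h₃
      rw [← h₄, h₇, add_mul]
      linarith
    · have := (hj.abs_lt h (hn k (by omega) j hj)).2
      omega

/-- At the first switch that violates the bound, the trace has come out along the leg from distance
`K m` without switching, with a bounded shift. The window in `GoodPlace` then forces a turn, but a
switch has none. -/
theorem IsTrace.switchesAt_lt (h : IsGluing d l r K) (ht : IsTrace d l r f a p δ) {m₀ : ℕ}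
    (hp : |p 0| < m₀) (n m : ℕ) (hs : SwitchesAt l r a p δ n m) : m < m₀ := by
  induction n using Nat.strong_induction_on generalizing m with
  | _ n ih =>
    by_contra! hm
    have hn : ∀ k < n, ∀ j, SwitchesAt l r a p δ k j → j < m :=
      fun k hk j hj => (ih k hk j hj).trans_le hm
    have hpK : |p 0| < K m := by
      have := h.le_bound m
      omega
    have hback := ht.backwards h hn hpK
    have hshift := ht.abs_shift_le h hn (by omega)
    obtain ⟨b, ⟨δ₀, s₀, hδ₀, hpn, hK, h₁, h₂, hwin⟩, hb, hb'⟩ := hs.exists_goodPlace h ht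
    have hsq : δ₀ * δ₀ = 1 := by rcases hδ₀ with rfl | rfl <;> norm_num
    have habs : ∀ x, 0 ≤ x → |δ₀ * x| = x := fun x hx => by
      rcases hδ₀ with rfl | rfl <;> simp [abs_of_nonneg hx]
    have hδδ : δ n = δ₀ ∨ δ n = -δ₀ := by
      have := ht.sign n
      omega
    rcases hδδ with hδ | hδ
    · have hpn' : p n = δ₀ * (s₀ - 1) := by
        rw [mul_sub, ← hpn, hδ]; ring
      have hsn : (n : ℤ) - δ n * p n = n + 1 - s₀ := by
        rw [hδ, hpn', ← mul_assoc, hsq]; ring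
      rw [hsn] at hshift
      have hlast : d (n + 1 - s₀ + s₀) = reading d δ₀ s₀ := hwin _ hshift fun s hs₁ hs₂ => by
        obtain ⟨i, hi⟩ := Int.le.dest (show s ≤ s₀ - 1 by omega)
        have hpi : ∀ i' : ℤ, p n - i' * δ n = δ₀ * (s₀ - 1 - i') := fun i' => by
          rw [hpn', hδ]; ring
        obtain ⟨h₃, h₄, h₅⟩ := hback i fun i' hi' => by
          rw [hpi, habs _ (by omega)]
          omega
        have h₆ := ht.read (n - i)
        rw [h₅, h₄, hpi, hδ, ← mul_assoc, hsq, one_mul, show s₀ - 1 - (i : ℤ) = s by omega] at h₆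
        rw [← h₆]
        congr 1
        push_cast [Nat.cast_sub h₃]
        omega
      rw [sub_add_cancel, h₂] at hlast
      push_cast at hb'
      rw [hb'] at hlast
      simp at hlast
    -- Arrival from further out could be traced back for `n + 1` steps, past the start of the trace.
    · have hpn' : p n = δ₀ * (s₀ + 1) := by
        rw [mul_add, ← hpn, hδ]; ring
      have := (hback (n + 1) fun i' _ => by
        rw [hpn', hδ, show δ₀ * (s₀ + 1) - i' * -δ₀ = δ₀ * (s₀ + 1 + i') by ring,
          habs _ (by omega)]
        omega).1
      omega

/-- Every ray with the right word eventually stays on one leg of one of the glued double rays. -/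
theorem IsTrace.exists_leg (h : IsGluing d l r K) (ht : IsTrace d l r f a p δ)
    (hd : HasFarTurns d) : ∃ c σ s₁, (σ = 1 ∨ σ = -1) ∧ HasFarTurns (reading d σ) ∧
      ∀ s, s₁ ≤ s → ∃ n, f n = glue l r (c, σ * s) := by
  let m₀ := (p 0).natAbs + 1
  have hm₀ := ht.switchesAt_lt h (m₀ := m₀) (by rw [Int.abs_eq_natAbs]; omega)
  obtain ⟨N, hN⟩ : ∃ N, ∀ n ≥ N, ∀ m, ¬ SwitchesAt l r a p δ n m := by
    -- Each switch passes one of the finitely many `l m` with `m < m₀`, and no vertex is passed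
    -- twice.
    have hfin : {n | f n ∈ l '' Set.Iio m₀}.Finite :=
      ((Set.finite_Iio m₀).image l).preimage ht.inj.injOn
    obtain ⟨N, hN⟩ := hfin.bddAbove
    refine ⟨N, fun n hn m hs => ?_⟩
    have : n + 1 ≤ N := hN ⟨m, hm₀ n m hs, (hs.apply_eq h ht).symm⟩
    omega
  have hcont : ∀ k : ℕ, a (N + k) = a N ∧ p (N + k) = p N + k * δ N ∧ δ (N + k) = δ N := by
    intro k
    induction k with
    | zero => simp
    | succ k ih =>
      rcases ht.continues_or_switches h (N + k) with ⟨h₁, h₂, h₃⟩ | ⟨m, hm⟩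
      · refine ⟨h₁.trans ih.1, ?_, h₃.trans ih.2.2⟩
        rw [← add_assoc, h₂, ih.2.1, ih.2.2]
        push_cast
        ring
      · exact absurd hm (hN _ (by omega) m)
  have hsq : δ N * δ N = 1 := by rcases ht.sign N with h₁ | h₁ <;> simp [h₁]
  refine ⟨a N, δ N, δ N * p N, ht.sign N, fun M => ?_, fun s hs => ?_⟩
  · have hread : ∀ x : ℤ, N ≤ x → d x = reading d (δ N) (x - N + δ N * p N) := fun x hx => by
      obtain ⟨k, rfl⟩ := Int.le.dest hx
      have h₁ := ht.read (N + k)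
      rw [(hcont k).2.1, (hcont k).2.2] at h₁
      push_cast at h₁
      rw [h₁, mul_add, mul_left_comm, hsq]
      congr 1
      ring
    obtain ⟨x, hx, hne⟩ := hd (max (N + 1) (M + N - δ N * p N))
    have hx₁ := (le_max_left _ _).trans hx
    have hx₂ := (le_max_right _ _).trans hx
    rw [hread x (by omega), hread (x - 1) (by omega)] at hne
    refine ⟨x - N + δ N * p N, by omega, ?_⟩
    rwa [show x - N + δ N * p N - 1 = x - 1 - N + δ N * p N by ring]
  · obtain ⟨k, rfl⟩ := Int.le.dest hs
    refine ⟨N + k, ?_⟩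
    rw [ht.start, (hcont k).1, (hcont k).2.1, mul_add, ← mul_assoc, hsq, one_mul, mul_comm (δ N)]

theorem exists_isGluing (hd : HasFarTurns d) : ∃ l r K, IsGluing d l r K ∧
    ∀ (a b : ℕ) (σ τ : ℤ), 2 * a < b → (σ = 1 ∨ σ = -1) → HasFarTurns (reading d σ) →
      (τ = 1 ∨ τ = -1) → HasFarTurns (reading d τ) →
      ∀ M : ℤ, ∃ m s t, M ≤ s ∧ M ≤ t ∧ l m = (a, σ * s) ∧ r m = (b, τ * t) := by
  let X := {q : (ℕ × ℤ) × (ℕ × ℤ) // 2 * q.1.1 < q.2.1 ∧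
    ((q.1.2 = 1 ∨ q.1.2 = -1) ∧ HasFarTurns (reading d q.1.2)) ∧
    ((q.2.2 = 1 ∨ q.2.2 = -1) ∧ HasFarTurns (reading d q.2.2))}
  have h1 : HasFarTurns (reading d 1) := by
    have : reading d 1 = d := by ext s; simp [reading]
    rwa [this]
  have : Nonempty X := ⟨⟨((0, 1), (1, 1)), by simp [h1]⟩⟩
  -- The factor `ℕ` makes every pair of legs occur infinitely often.
  obtain ⟨E, hE⟩ := exists_surjective_nat (ℕ × X)
  have hEinf : ∀ (x : X) (M : ℕ), ∃ m ≥ M, (E m).2 = x := fun x M => by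
    have hinf : {m | (E m).2 = x}.Infinite := by
      refine Set.Infinite.of_image (fun m => (E m).1) ?_
      have : (fun m => (E m).1) '' {m | (E m).2 = x} = Set.univ := by
        refine Set.eq_univ_of_forall fun n => ?_
        obtain ⟨m, hm⟩ := hE (n, x)
        exact ⟨m, by simp [hm], by simp [hm]⟩
      rw [this]
      exact Set.infinite_univ
    obtain ⟨m, hm, hmM⟩ := hinf.exists_gt M
    exact ⟨m, hmM.le, hm⟩
  choose zl hzl hzl' using fun (m k : ℕ) =>
    exists_goodPlace (E m).2.2.2.1.1 (E m).2.2.2.1.2 k (m + 2 * m * k) false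
  choose zr hzr hzr' using fun (m k : ℕ) =>
    exists_goodPlace (E m).2.2.2.2.1 (E m).2.2.2.2.2 k (m + 2 * m * k) true
  let K : ℕ → ℕ := fun m => Nat.rec 0 (fun m k => (zl m k).natAbs + (zr m k).natAbs + 1) m
  have hK : ∀ m, K (m + 1) = (zl m (K m)).natAbs + (zr m (K m)).natAbs + 1 := fun m => rfl
  have hKlt : ∀ m, m ≤ K m ∧ K m < K (m + 1) := fun m => by
    have hlt : ∀ m, K m < K (m + 1) := fun m => by
      have := hzl m (K m)
      rw [hK]
      omega
    refine ⟨?_, hlt m⟩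
    induction m with
    | zero => omega
    | succ m ih => have := hlt m; omega
  have hKmono : StrictMono K := strictMono_nat_of_lt_succ fun m => (hKlt m).2
  have habs : ∀ σ x : ℤ, (σ = 1 ∨ σ = -1) → |σ * x| = |x| := fun σ x hσ => by
    rcases hσ with rfl | rfl <;> simp
  refine ⟨fun m => ((E m).2.1.1.1, (E m).2.1.1.2 * zl m (K m)),
    fun m => ((E m).2.1.2.1, (E m).2.1.2.2 * zr m (K m)), K,
    ⟨fun m => (E m).2.2.1, fun j m hj => ?_, fun m => hzl' m _, fun m => hzr' m _⟩, ?_⟩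
  · have h₁ : K (j + 1) ≤ K m := hKmono.monotone hj
    simp only [habs _ _ (E j).2.2.2.1.1, habs _ _ (E j).2.2.2.2.1, Int.abs_eq_natAbs]
    rw [hK] at h₁
    omega
  · intro a b σ τ hab hσ hσ' hτ hτ' M
    obtain ⟨m, hm, hEm⟩ := hEinf ⟨((a, σ), (b, τ)), hab, ⟨hσ, hσ'⟩, hτ, hτ'⟩ M.toNat
    have h₁ := hzl m (K m)
    have h₂ := hzr m (K m)
    have h₃ := (hKlt m).1
    exact ⟨m, zl m (K m), zr m (K m), by omega, by omega, by simp only [hEm], by simp only [hEm]⟩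

theorem IsGluing.exists_disjoint (h : IsGluing d l r K) (k : ℕ) :
    ∃ f : Fin k → ℤ → ℕ × ℤ, (∀ i, Function.Injective (f i)) ∧
      (∀ i, (glued d l r).Follows d (f i)) ∧ ∀ i j x y, f i x = f j y → i = j := by
  have key : ∀ (i j : Fin k) (x y : ℤ), glue l r (k + i, x) = glue l r (k + j, y) →
      i = j ∧ x = y := by
    intro i j x y hxy
    rcases h.eq_of_glue_eq hxy with h' | ⟨m, ⟨h₁, h₂⟩ | ⟨h₁, h₂⟩⟩
    · simp only [Prod.mk.injEq] at h'
      exact ⟨Fin.ext (by omega), h'.2⟩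
    · have := h.lt m
      rw [← h₁, ← h₂] at this
      simp only at this
      omega
    · have := h.lt m
      rw [← h₁, ← h₂] at this
      simp only at this
      omega
  exact ⟨fun i z => glue l r (k + i, z), fun i x y hxy => (key i i x y hxy).2,
    fun i z => ⟨fun hz => ⟨k + i, z, Or.inl ⟨hz, rfl, rfl⟩⟩,
      fun hz => ⟨k + i, z, Or.inr ⟨hz, rfl, rfl⟩⟩⟩,
    fun i j x y hxy => (key i j x y hxy).1⟩

end Gluing

/-- An oriented double ray with infinitely many turns is not ubiquitous. -/
theorem IsWord.not_isUbiquitous_of_infinite {V : Type u} {R : Digraph V} {e : ℤ ≃ V}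
    {d : ℤ → Bool} (h : R.IsWord e d) (hinf : (turnPositions d).Infinite) :
    ¬ IsUbiquitous.{u, v} R := by
  have key : ∀ (e' : ℤ ≃ V) (d' : ℤ → Bool), R.IsWord e' d' → HasFarTurns d' →
      ¬ IsUbiquitous.{u, v} R := by
    intro e' d' h' hd
    obtain ⟨l, r, K, hg, hmeet⟩ := exists_isGluing hd
    refine h'.not_isUbiquitous (glued d' l r) hg.exists_disjoint ?_
    rintro ⟨f, hf, hF, hdis⟩
    have hleg : ∀ i, ∃ c σ s₁, (σ = 1 ∨ σ = -1) ∧ HasFarTurns (reading d' σ) ∧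
        ∀ s, s₁ ≤ s → ∃ n : ℕ, f i n = glue l r (c, σ * s) := fun i => by
      obtain ⟨a, p, δ, ht⟩ := exists_isTrace (hf i) (hF i)
      exact ht.exists_leg hg hd
    choose c σ s₁ hσ hfar hs using hleg
    -- Disjoint copies cannot end on the same leg, and only finitely many legs lie on double rays
    -- numbered at most `2 * c 0`.
    have hinj : Function.Injective fun i => (c i, σ i) := fun i j hij => by
      simp only [Prod.mk.injEq] at hij
      obtain ⟨n, hn⟩ := hs i (max (s₁ i) (s₁ j)) (le_max_left _ _)
      obtain ⟨n', hn'⟩ := hs j (max (s₁ i) (s₁ j)) (le_max_right _ _)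
      rw [← hij.1, ← hij.2, ← hn] at hn'
      exact hdis i j _ _ hn'.symm
    obtain ⟨j, hj⟩ : ∃ j, 2 * c 0 < c j := by
      by_contra! hle
      refine Set.infinite_of_injective_forall_mem hinj (fun j => ?_)
        ((Set.finite_Iic (2 * c 0)).prod ((Set.finite_singleton (1 : ℤ)).insert (-1)))
      refine ⟨hle j, ?_⟩
      have := hσ j
      simp only [Set.mem_insert_iff, Set.mem_singleton_iff]
      exact this.symm
    obtain ⟨m, s, t, hs', ht', hl, hr⟩ := hmeet (c 0) (c j) (σ 0) (σ j) hj (hσ 0) (hfar 0) (hσ j)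
      (hfar j) (max (s₁ 0) (s₁ j))
    obtain ⟨n, hn⟩ := hs 0 s ((le_max_left _ _).trans hs')
    obtain ⟨n', hn'⟩ := hs j t ((le_max_right _ _).trans ht')
    rw [← hl, hg.glue_left] at hn
    rw [← hr, hg.glue_right] at hn'
    have := hdis 0 j _ _ (hn.trans hn'.symm)
    subst this
    omega
  by_contra hu
  have h₁ : ¬ HasFarTurns d := fun hd => key _ _ h hd hu
  have h₂ : ¬ HasFarTurns (flipWord d) := fun hd => key _ _ h.flip hd hu
  simp only [HasFarTurns, not_forall, not_exists, not_and, not_not] at h₁ h₂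
  obtain ⟨A, hA⟩ := h₁
  obtain ⟨B, hB⟩ := h₂
  refine hinf ((Set.finite_Ioo (-B) A).subset fun i hi => ⟨?_, ?_⟩)
  · by_contra! hle
    have := hB (-i) (by omega)
    simp only [flipWord] at this
    rw [show -(-i - 1) - 1 = i by ring, neg_neg, Bool.not_eq_eq_eq_not, Bool.not_not] at this
    exact hi this.symm
  · by_contra! hle
    exact hi (hA i hle)

end Digraph

/-! ### The three cases combined -/

theorem theorem1p2 {V : Type u} (R : Digraph V) (hR : R.IsOrientedDoubleRay)
    (hturn : R.turns.Nonempty) :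
    Digraph.IsUbiquitous.{u, v} R ↔ R.turns.Finite ∧ Odd R.turns.ncard := by
  obtain ⟨e, d, h⟩ := hR.exists_isWord
  rw [h.turns_eq] at hturn ⊢
  rw [Set.finite_image_iff e.injective.injOn, Set.ncard_image_of_injective _ e.injective]
  by_cases hfin : (Digraph.turnPositions d).Finite
  · obtain ⟨N, hN, hr, hl⟩ := Digraph.exists_bound_of_finite_turnPositions hfin
    rw [Digraph.odd_ncard_turnPositions_iff hN]
    by_cases hne : d N = d (-N)
    · simp only [hne, ne_eq, not_true_eq_false, and_false, iff_false]
      exact h.not_isUbiquitous_of_eq (fun i hi => (hr i hi).trans hne) hl hturn.of_image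
    · refine iff_of_true (h.isUbiquitous hr fun i hi => ?_) ⟨hfin, hne⟩
      rw [hl i hi]
      exact Bool.eq_not_of_ne (Ne.symm hne)
  · simp only [hfin, false_and, iff_false]
    exact h.not_isUbiquitous_of_infinite hfin
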